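/- **Setting.** Let $\mathcal X\subset\mathbb R^d$ be closed, convex and bounded, with $\ell_2$-diameter $\|\mathcal X\|$; let $m\ge 0$ be the memory length, $T\ge\max(m,2)$ the horizon and $\mathcal T=\{m,\dots,T\}$. In round $t$ the loss and the constraint are separable with memory and linear: $f_t(x_{t-m},\dots,x_t)=\sum_{i=0}^m f_t^i(x_{t-i})$ and $g_t(x_{t-m},\dots,x_t)=\sum_{i=0}^m g_t^i(x_{t-i})$, where $f_t^i,g_t^i$ are affine on $\mathbb R^d$ (with gradients $\nabla f_t^i$, $\nabla g_t^i$). For $t\in\mathcal T$ one has $|f_t|\le F$ and $|g_t|\le G$ on $\mathcal X^{m+1}$, $G>0$, and $f_t$, $g_t$ are Lipschitz on $(\mathbb R^d)^{m+1}$ with constants $L_f$, $L_g$ for the $\ell_2$ norm; $f_t=g_t=0$ for $t\le m$ and for $t>T$. Write $z^+=\max\{z,0\}$, and let $g_t^{i,+}=(g_t^i)^+$. The benchmark set $$\mathcal X_T^{mp}=\{u\in\mathcal X:\ g_t^i(u)\le 0\ \ \forall t\in\mathcal T,\ 0\le i\le m\}$$ is assumed nonempty. For decisions $x_0,x_1,\dots\in\mathcal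 X$ put $V_t=\sum_{k=m}^t g_k^+(x_{k-m},\dots,x_k)$ (so $V_t=0$ for $t\le m$, also for negative $t$), and $$\mathcal R_T^{mc}=\sum_{t=m}^T f_t(x_{t-m},\dots,x_t)-\min_{u\in\mathcal X_T^{mp}}\sum_{t=m}^T f_t(u,\dots,u),\qquad \mathcal V_T^{mc}=V_T .$$ **Algorithm.** Let $\Phi(V)=e^{\lambda V}-1$, $w_k=\Phi'(V_{k-m-1})$, and let $\nabla g_{s+i}^{i,+}$ denote a subgradient of $g_{s+i}^{i,+}$ at $x_s$. The forward function $Z_s(x)=\sum_{i=0}^m f_{s+i}^i(x)+w_{s+i}\,g_{s+i}^{i,+}(x)$ has the (sub)gradient $\nabla Z_s=\sum_{i=0}^m(\nabla f_{s+i}^i+w_{s+i}\nabla g_{s+i}^{i,+})$ at $x_s$. Before $x_t$ is chosen, an untrusted oracle supplies arbitrary forecasts $\nabla\tilde f_{s+i}^i$ and $\nabla\tilde g_{s+i}^{i,+}$ of the slices that are still unknown ($t-m\le s\le t\le s+i$), of norm at most $L_f$ and $L_g$; they may be revised in every round. (Indices $s<0$ are omitted throughout.) The hint is $$h_t=\sum_{s=t-m}^t\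 \sum_{i=0}^m\begin{cases}\nabla f_{s+i}^i+w_{s+i}\nabla g_{s+i}^{i,+}, & s+i<t,\\ \nabla\tilde f_{s+i}^i+w_{s+i}\nabla\tilde g_{s+i}^{i,+}, & s+i\ge t.\end{cases}$$ Let $\alpha>0$, and let $r$ be a $1$-strongly convex function on $\mathcal X$ with $0\le r\le\rho$ there. With $e_t=\|h_t-\sum_{s=t-m}^t\nabla Z_s\|$, $a_t=\|\mathcal X\|\min(e_t,\|\nabla Z_t\|)$ and $b_t=\tfrac12e_t^2-\tfrac12\big((e_t-\|\nabla Z_t\|)^+\big)^2$, ODAF starts from an arbitrary initial history in $\mathcal X$ (rounds $0,\dots,m+1$) and chooses, for $t=m+1,\dots,T-1$, $$x_{t+1}\in\arg\min_{x\in\mathcal X}\Big\langle \sum_{s=1}^{t-m}\nabla Z_s+h_{t+1},x\Big\rangle+\mu_{t+1}r(x),\qquad \mu_{t+1}=\frac2\alpha\max_{j\le t-m-1}\ \sum_{k=j-m+1}^{j}a_k+\frac1\alpha\sqrt{\sum_{i=1}^{t-m}(a_i^2+2\alpha b_i)} ,$$ where $a_k=0$ for $k\le 0$ and the maximum over an empty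 set of indices is $0$. **Prediction errors.** $\mathcal E_T(f)=\sum_{t=m}^T\epsilon_t(f)$ and $\mathcal E_T(g^+)=\sum_{t=m}^T\epsilon_t(g^+)$, where $$\epsilon_t(f)=\Big\|\sum_{s=t-m}^t\sum_{i=t-s}^m(\nabla\tilde f_{s+i}^i-\nabla f_{s+i}^i)\Big\|^2,\qquad \epsilon_t(g^+)=\max_{t\le k\le t+m}\Big\|\sum_{s=t-m}^t\sum_{i=k-s}^m(\nabla\tilde g_{s+i}^{i,+}-\nabla g_{s+i}^{i,+})\Big\|^2 ,$$ the forecasts being those available when $x_t$ is chosen. **Theorem.** Put $C_0=\sqrt2\,(\rho/\alpha+1)\big(2m\|\mathcal X\|+\sqrt{\|\mathcal X\|^2+\alpha}\big)$, let $C\ge C_0$, and let $$\lambda=\frac1{2\left(C\sqrt{\mathcal E_T(g^+)}+G(m+1)\right)} .$$ Then $$\mathcal R_T^{mc}\le C_0\sqrt{\mathcal E_T(f)}+A_m,\qquad \mathcal V_T^{mc}\le K\left(C\sqrt{\mathcal E_T(g^+)}+m+1\right)\log T .$$ Here $K$ depends only on $\alpha,\rho,F,G,L_f,L_g$ and an upper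 bound $D$ for $\|\mathcal X\|$, and $A_m$ only on these and on $m$; neither depends on $d$, $T$, $C$, the functions, the forecasts, $r$ or the run. That is, $\mathcal R_T^{mc}=\mathcal O(1+\sqrt{\mathcal E_T(f)})$ and $\mathcal V_T^{mc}=\mathcal O\big((\sqrt{\mathcal E_T(g^+)}+m+1)\log T\big)$ for fixed $C$ and $m$. -/

import Mathlib

open scoped RealInnerProductSpace

namespace CocoMemory

/-- The ambient space `ℝ^d` with its `ℓ₂` norm. -/
abbrev Space (d : ℕ) := EuclideanSpace ℝ (Fin d)

/-- A linear (affine) function `x ↦ ⟪slope, x⟫ + offset` on `ℝ^d`; its gradient is `slope`. -/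
structure LinFun (d : ℕ) where
  slope : Space d
  offset : ℝ

/-- The value of a linear function at a point. -/
noncomputable def LinFun.eval {d : ℕ} (φ : LinFun d) (x : Space d) : ℝ :=
  ⟪φ.slope, x⟫ + φ.offset

/-- The value of the separable memory function with components `φ 0, …, φ m`;
`y i` is the argument of component `i`, i.e. the decision that was made `i` rounds ago. -/
noncomputable def memVal {d : ℕ} (m : ℕ) (φ : ℕ → LinFun d) (y : ℕ → Space d) : ℝ :=
  ∑ i ∈ Finset.range (m + 1), (φ i).eval (y i)

/-- The data of the online problem with memory length `m` and horizon `T`: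
`f t i` and `g t i` are the components `f_t^i`, `g_t^i` that act on the decision of round `t - i`. -/
structure Problem (d : ℕ) where
  m : ℕ
  T : ℕ
  X : Set (Space d)
  f : ℕ → ℕ → LinFun d
  g : ℕ → ℕ → LinFun d

/-- Everything that the learner uses or produces.
* `x t` is the decision of round `t`;
* `gradG s i` is the (sub)gradient of `g_{s+i}^{i,+}` at `x s`;
* `predF t s i`, `predG t s i` are the forecasts, available when `x t` is chosen, of the gradients
  of `f_{s+i}^i` and `g_{s+i}^{i,+}` at `x s`;
* `r` is the regularizer, `α` the parameter of its adaptive weight, `lam` the penalty parameter. -/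
structure Run (d : ℕ) where
  x : ℕ → Space d
  gradG : ℕ → ℕ → Space d
  predF : ℕ → ℕ → ℕ → Space d
  predG : ℕ → ℕ → ℕ → Space d
  r : Space d → ℝ
  α : ℝ
  lam : ℝ

/-- `v` is a subgradient of `φ` at `x`. -/
def IsSubgradientAt {d : ℕ} (φ : Space d → ℝ) (v x : Space d) : Prop :=
  ∀ y, φ x + ⟪v, y - x⟫ ≤ φ y

/-- The penalty function `Φ(V) = exp(λ V) - 1`. -/
noncomputable def penalty (lam V : ℝ) : ℝ := Real.exp (lam * V) - 1

/-- `huber(x, y) = x² / 2 - (|x| - |y|)₊² / 2`. -/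
noncomputable def huber (x y : ℝ) : ℝ := x ^ 2 / 2 - (max (|x| - |y|) 0) ^ 2 / 2

namespace Problem

variable {d : ℕ}

/-- The standing assumptions: a closed convex bounded decision set; losses and constraints that are
bounded by `F` and `G` on `X^{m+1}` and Lipschitz with constants `Lf` and `Lg` for the `ℓ₂` norm on
`(ℝ^d)^{m+1}`; no loss and no constraint outside the rounds `m + 1, …, T`. -/
structure Assumptions (P : Problem d) (F G Lf Lg : ℝ) : Prop where
  closed : IsClosed P.X
  convex : Convex ℝ P.X
  bounded : Bornology.IsBounded P.X
  f_bdd : ∀ t ∈ Finset.Icc P.m P.T, ∀ y : ℕ → Space d, (∀ i ≤ P.m, y i ∈ P.X) →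
    |memVal P.m (P.f t) y| ≤ F
  g_bdd : ∀ t ∈ Finset.Icc P.m P.T, ∀ y : ℕ → Space d, (∀ i ≤ P.m, y i ∈ P.X) →
    |memVal P.m (P.g t) y| ≤ G
  f_lip : ∀ t ∈ Finset.Icc P.m P.T, ∀ y z : ℕ → Space d,
    |memVal P.m (P.f t) y - memVal P.m (P.f t) z| ≤
      Lf * √(∑ i ∈ Finset.range (P.m + 1), ‖y i - z i‖ ^ 2)
  g_lip : ∀ t ∈ Finset.Icc P.m P.T, ∀ y z : ℕ → Space d,
    |memVal P.m (P.g t) y - memVal P.m (P.g t) z| ≤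
      Lg * √(∑ i ∈ Finset.range (P.m + 1), ‖y i - z i‖ ^ 2)
  f_zero : ∀ t, t ≤ P.m ∨ P.T < t → ∀ i, P.f t i = ⟨0, 0⟩
  g_zero : ∀ t, t ≤ P.m ∨ P.T < t → ∀ i, P.g t i = ⟨0, 0⟩

/-- The benchmark set `X_T^{mp}`. -/
def benchmark (P : Problem d) : Set (Space d) :=
  {u | u ∈ P.X ∧ ∀ t ∈ Finset.Icc P.m P.T, ∀ i ≤ P.m, (P.g t i).eval u ≤ 0}

/-- `f_t(x_{t-m}, …, x_t)` for the decisions `x`. -/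
noncomputable def lossAt (P : Problem d) (x : ℕ → Space d) (t : ℕ) : ℝ :=
  memVal P.m (P.f t) (fun i => x (t - i))

/-- `g_t(x_{t-m}, …, x_t)` for the decisions `x`. -/
noncomputable def constrAt (P : Problem d) (x : ℕ → Space d) (t : ℕ) : ℝ :=
  memVal P.m (P.g t) (fun i => x (t - i))

/-- The regret `R_T^{mc}` against the best fixed decision in the benchmark set. -/
noncomputable def regret (P : Problem d) (x : ℕ → Space d) : ℝ :=
  ∑ t ∈ Finset.Icc P.m P.T, P.lossAt x t -
    sInf ((fun u => ∑ t ∈ Finset.Icc P.m P.T, P.lossAt (fun _ => u) t) '' P.benchmark)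

/-- The cumulative constraint violation `V_t`, with `V_t = 0` for `t < m`. -/
noncomputable def violation (P : Problem d) (x : ℕ → Space d) (t : ℕ) : ℝ :=
  ∑ k ∈ Finset.Icc P.m t, max (P.constrAt x k) 0

end Problem

namespace Run

variable {d : ℕ}

/-- The multiplier `Φ'(V_{k-m-1})` of the constraint components of round `k`. For `k ≤ m` the
truncated difference gives `Φ'(V_0)`, and `V_0 = 0` under the standing assumptions. -/
noncomputable def weight (R : Run d) (P : Problem d) (k : ℕ) : ℝ :=
  deriv (penalty R.lam) (P.violation R.x (k - P.m - 1))

/-- The gradient `∇Z_s(x_s)` of the forward function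
`Z_s(x) = ∑_{i ≤ m} f_{s+i}^i(x) + Φ'(V_{s-m-1+i}) g_{s+i}^{i,+}(x)`. -/
noncomputable def gradZ (R : Run d) (P : Problem d) (s : ℕ) : Space d :=
  ∑ i ∈ Finset.range (P.m + 1), ((P.f (s + i) i).slope + R.weight P (s + i) • R.gradG s i)

/-- The hint `h_t`, an estimate of `∇Z_{t-m} + ⋯ + ∇Z_t`: a slice of `Z_s` that belongs to a round
`s + i < t` is known when `x_t` is chosen, the others are replaced by their forecasts. -/
noncomputable def hint (R : Run d) (P : Problem d) (t : ℕ) : Space d :=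
  ∑ s ∈ Finset.Icc (t - P.m) t, ∑ i ∈ Finset.range (P.m + 1),
    if s + i < t then (P.f (s + i) i).slope + R.weight P (s + i) • R.gradG s i
    else R.predF t s i + R.weight P (s + i) • R.predG t s i

/-- The size `‖h_t - ∇Z_{t-m:t}‖` of the error of the hint. -/
noncomputable def hintErr (R : Run d) (P : Problem d) (t : ℕ) : ℝ :=
  ‖R.hint P t - ∑ s ∈ Finset.Icc (t - P.m) t, R.gradZ P s‖

/-- `a_t = ‖X‖ min(‖h_t - ∇Z_{t-m:t}‖, ‖∇Z_t‖)`. -/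
noncomputable def aTerm (R : Run d) (P : Problem d) (t : ℕ) : ℝ :=
  Metric.diam P.X * min (R.hintErr P t) ‖R.gradZ P t‖

/-- `b_t = huber(‖h_t - ∇Z_{t-m:t}‖, ‖∇Z_t‖)`. -/
noncomputable def bTerm (R : Run d) (P : Problem d) (t : ℕ) : ℝ :=
  huber (R.hintErr P t) ‖R.gradZ P t‖

/-- `muNext t` is the weight `μ_{t+1}` of the regularizer, i.e.
`(2/α) max_{j ≤ t-m-1} a_{j-m+1:j} + (1/α) √(∑_{i=1}^{t-m} (a_i² + 2 α b_i))`.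
Here `a_0 = 0`, because `Z_0 = 0` under the standing assumptions. -/
noncomputable def muNext (R : Run d) (P : Problem d) (t : ℕ) : ℝ :=
  2 / R.α * (Finset.range (t - P.m - 1 + 1)).sup' Finset.nonempty_range_add_one
      (fun j => ∑ k ∈ Finset.Icc (j + 1 - P.m) j, R.aTerm P k) +
    1 / R.α * √(∑ i ∈ Finset.Icc 1 (t - P.m), (R.aTerm P i ^ 2 + 2 * R.α * R.bTerm P i))

/-- The objective that the learner minimizes over `X` to find the decision of round `t + 1`. -/
noncomputable def objNext (R : Run d) (P : Problem d) (t : ℕ) (y : Space d) : ℝ :=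
  ⟪∑ s ∈ Finset.Icc 1 (t - P.m), R.gradZ P s + R.hint P (t + 1), y⟫ + R.muNext P t * R.r y

/-- `R` is a run of the optimistic delayed adaptive FTRL algorithm on the forward functions of `P`,
with an arbitrary initial history, arbitrary forecasts of norm at most `Lf` and `Lg`, and a
nonnegative regularizer that is `1`-strongly convex and bounded by `ρ` on `X`. -/
structure IsODAF (R : Run d) (P : Problem d) (Lf Lg ρ : ℝ) : Prop where
  strong : StrongConvexOn P.X 1 R.r
  r_nonneg : ∀ y ∈ P.X, 0 ≤ R.r y
  r_le : ∀ y ∈ P.X, R.r y ≤ ρ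
  mem : ∀ t ≤ P.T, R.x t ∈ P.X
  subgrad : ∀ s ≤ P.T, ∀ i ≤ P.m,
    IsSubgradientAt (fun y => max ((P.g (s + i) i).eval y) 0) (R.gradG s i) (R.x s)
  predF_le : ∀ t s i, ‖R.predF t s i‖ ≤ Lf
  predG_le : ∀ t s i, ‖R.predG t s i‖ ≤ Lg
  update : ∀ t, P.m + 1 ≤ t → t + 1 ≤ P.T → IsMinOn (R.objNext P t) P.X (R.x (t + 1))

/-- The loss prediction error `ε_t(f)`: the slices of `Z_{t-m}, …, Z_t` that are still unknown when
`x_t` is chosen are those with `i ≥ t - s`. -/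
noncomputable def epsF (R : Run d) (P : Problem d) (t : ℕ) : ℝ :=
  ‖∑ s ∈ Finset.Icc (t - P.m) t, ∑ i ∈ Finset.Icc (t - s) P.m,
    (R.predF t s i - (P.f (s + i) i).slope)‖ ^ 2

/-- The constraint prediction error `ε_t(g⁺)`. As for the losses, but slices of different rounds
`s + i` carry different multipliers, so the error is the largest one over the tails `s + i ≥ t + j`,
`0 ≤ j ≤ m`, of the unknown slices; `j = 0` gives all of them. -/
noncomputable def epsG (R : Run d) (P : Problem d) (t : ℕ) : ℝ :=
  (Finset.range (P.m + 1)).sup' Finset.nonempty_range_add_one (fun j =>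
    ‖∑ s ∈ Finset.Icc (t - P.m) t, ∑ i ∈ Finset.Icc (t + j - s) P.m,
      (R.predG t s i - R.gradG s i)‖ ^ 2)

/-- The cumulative error `E_T(f)`. -/
noncomputable def errF (R : Run d) (P : Problem d) : ℝ :=
  ∑ t ∈ Finset.Icc P.m P.T, R.epsF P t

/-- The cumulative error `E_T(g⁺)`. -/
noncomputable def errG (R : Run d) (P : Problem d) : ℝ :=
  ∑ t ∈ Finset.Icc P.m P.T, R.epsG P t

end Run

/-- The constant `√2 (ρ/α + 1) (2 m D + √(D² + α))` of the regret bound, where `D` is the diameter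
of `X` and `ρ` bounds the regularizer. -/
noncomputable def regretConst (m : ℕ) (D α ρ : ℝ) : ℝ :=
  √2 * (ρ / α + 1) * (2 * m * D + √(D ^ 2 + α))

end CocoMemory

/-!
The forward functions make the memory disappear: summing the slices of `f_t` and `w_t g_t⁺` that act
on `x_s` shows that the regret plus the penalty `∑ w_t g_t⁺` is at most the linearized regret
`∑ ⟪∇Z_s, x_s - u⟫` of optimistic FTRL with gradients delayed by `m` rounds. The drifts of FTRL are
self-bounding, which turns the adaptive weights into a regret of order `√(∑ e_t²)` for the errors
`e_t` of the hints. Since the multipliers `w` are nondecreasing, summation by parts bounds `e_t` by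
`√ε_t(f) + λ exp(λ V_T) √ε_t(g⁺)`.

The choice of `λ` makes the violation grow by at most a constant factor during the delay, so that
the penalty is at least `3/5 (exp(λ V_T) - 1)`, whereas the forecast errors of the constraints cost
at most `exp(λ V_T) / 2`. Hence the regret plus `exp(λ V_T) / 10` is at most `C₀ √E_T(f)` plus a
constant: this is the regret bound, and, as the regret is at least `-2 F (T + 1)`, it also shows
that `exp(λ V_T)` is polynomial in `T`.
-/

namespace CocoMemory

open Filter Finset Topology

lemma sum_le_mul_of_card_le {ι : Type*} {s : Finset ι} {f : ι → ℝ} {n : ℕ} {B : ℝ} (hs : #s ≤ n)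
    (hB : 0 ≤ B) (hf : ∀ i ∈ s, f i ≤ B) : ∑ i ∈ s, f i ≤ n * B := by
  refine (sum_le_card_nsmul _ _ B hf).trans ?_
  rw [nsmul_eq_mul]
  gcongr

lemma norm_sum_le_mul_of_card_le {ι E : Type*} [SeminormedAddCommGroup E] {s : Finset ι}
    {f : ι → E} {n : ℕ} {B : ℝ} (hs : #s ≤ n) (hB : 0 ≤ B) (hf : ∀ i ∈ s, ‖f i‖ ≤ B) :
    ‖∑ i ∈ s, f i‖ ≤ n * B :=
  (norm_sum_le _ _).trans (sum_le_mul_of_card_le hs hB hf)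

section Numerics

variable {a b v y N T : ℝ}

lemma le_of_sq_le_mul (hb : 0 ≤ b) (h : a ^ 2 ≤ b * a) : a ≤ b := by
  by_contra! hlt
  nlinarith

lemma sqrt_add_le (ha : 0 ≤ a) (hb : 0 ≤ b) : √(a + b) ≤ √a + √b := by
  refine Real.sqrt_le_iff.2 ⟨by positivity, ?_⟩
  rw [add_sq, Real.sq_sqrt ha, Real.sq_sqrt hb]
  linarith [mul_nonneg (Real.sqrt_nonneg a) (Real.sqrt_nonneg b)]

lemma exp_sub_exp_le (a b : ℝ) : Real.exp b - Real.exp a ≤ (b - a) * Real.exp b := by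
  have hle := mul_le_mul_of_nonneg_left (Real.one_sub_le_exp_neg (b - a)) (Real.exp_nonneg b)
  rw [← Real.exp_add, neg_sub, add_sub_cancel] at hle
  linarith

lemma exp_half_le : Real.exp (1 / 2) ≤ 5 / 3 := by
  have hsq : Real.exp (1 / 2) ^ 2 = Real.exp 1 := by
    rw [← Real.exp_nat_mul]
    norm_num
  refine le_of_sq_le_sq ?_ (by norm_num)
  rw [hsq]
  linarith [Real.exp_one_lt_d9]

lemma le_log_of_exp_le (hN : 1 ≤ N) (hT : 2 ≤ T) (h : Real.exp v ≤ N * (T + 1) ^ 4) :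
    v ≤ (Real.log N / Real.log 2 + 8) * Real.log T := by
  have hpow : (T + 1) ^ 4 ≤ (T ^ 2) ^ 4 := pow_le_pow_left₀ (by linarith) (by nlinarith) 4
  have hexp : Real.exp v ≤ N * T ^ 8 := by
    rw [← pow_mul] at hpow
    exact h.trans (mul_le_mul_of_nonneg_left hpow (by linarith))
  have hlog := Real.log_le_log (Real.exp_pos v) hexp
  rw [Real.log_exp, Real.log_mul (by positivity) (by positivity), Real.log_pow] at hlog
  have hlogN : Real.log N ≤ Real.log N / Real.log 2 * Real.log T := by
    rw [div_mul_eq_mul_div, le_div_iff₀ (Real.log_pos one_lt_two)]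
    exact mul_le_mul_of_nonneg_left (Real.log_le_log two_pos hT) (Real.log_nonneg hN)
  push_cast at hlog
  linarith

lemma one_div_two_mul_mul_le_half (hy : 0 < y) (hay : a ≤ y) : 1 / (2 * y) * a ≤ 1 / 2 := by
  rw [one_div_mul_eq_div, div_le_iff₀ (by positivity)]
  linarith

lemma add_mul_le_max_mul (c : ℝ) (ha : 0 ≤ a) (hb : 0 ≤ b) :
    a + c * b ≤ max 1 c * (a + b) := by
  have hleft := mul_le_mul_of_nonneg_right (le_max_left 1 c) ha
  have hright := mul_le_mul_of_nonneg_right (le_max_right 1 c) hb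
  linarith

end Numerics

/-! ### Follow the regularized leader -/

lemma add_sq_norm_sub_le_of_isMinOn {E : Type*} [NormedAddCommGroup E] [NormedSpace ℝ E]
    {X : Set E} {φ : E → ℝ} {σ : ℝ} (hφ : StrongConvexOn X σ φ) {v w : E} (hv : v ∈ X)
    (hmin : IsMinOn φ X v) (hw : w ∈ X) : φ v + σ / 2 * ‖w - v‖ ^ 2 ≤ φ w := by
  have hsegment : ∀ θ ∈ Set.Ioo (0 : ℝ) 1, (1 - θ) * (σ / 2 * ‖w - v‖ ^ 2) ≤ φ w - φ v := by
    rintro θ ⟨hθ0, hθ1⟩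
    have hle : φ v ≤ φ (θ • w + (1 - θ) • v) :=
      hmin (hφ.1 hw hv hθ0.le (sub_nonneg.2 hθ1.le) (by ring))
    have hconv := hφ.2 hw hv hθ0.le (sub_nonneg.2 hθ1.le) (by ring)
    simp only [smul_eq_mul] at hconv
    refine le_of_mul_le_mul_left ?_ hθ0
    linarith
  have hlim : Tendsto (fun θ : ℝ => (1 - θ) * (σ / 2 * ‖w - v‖ ^ 2)) (𝓝[>] 0)
      (𝓝 ((1 - 0) * (σ / 2 * ‖w - v‖ ^ 2))) :=
    (Continuous.tendsto (by fun_prop) 0).mono_left nhdsWithin_le_nhds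
  have hgrowth := le_of_tendsto hlim
    (eventually_of_mem (Ioo_mem_nhdsGT one_pos) hsegment)
  linarith

lemma exists_huber_eq {e γ : ℝ} (he : 0 ≤ e) (hγ : 0 ≤ γ) :
    ∃ τ ∈ Set.Icc (0 : ℝ) 1, (1 - τ) * γ = (1 - τ) * (τ * e) ∧
      huber e γ = τ * (2 - τ) * e ^ 2 / 2 := by
  rw [huber, abs_of_nonneg he, abs_of_nonneg hγ]
  rcases le_or_gt e γ with h | h
  · exact ⟨1, by simp, by simp, by rw [max_eq_right (sub_nonpos.2 h)]; ring⟩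
  · have he0 : 0 < e := hγ.trans_lt h
    refine ⟨γ / e, ⟨by positivity, (div_le_one he0).2 h.le⟩, by rw [div_mul_cancel₀ _ he0.ne'], ?_⟩
    rw [max_eq_left (sub_nonneg.2 h.le)]
    field_simp
    ring

lemma huber_nonneg {e γ : ℝ} (he : 0 ≤ e) (hγ : 0 ≤ γ) : 0 ≤ huber e γ := by
  obtain ⟨τ, ⟨hτ0, hτ1⟩, -, hτ⟩ := exists_huber_eq he hγ
  have : 0 ≤ 2 - τ := by linarith
  rw [hτ]
  positivity

lemma huber_le (e γ : ℝ) : huber e γ ≤ e ^ 2 / 2 :=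
  sub_le_self _ (by positivity)

section FTRL

variable {E : Type*} [NormedAddCommGroup E] [InnerProductSpace ℝ E]
  {X : Set E} {ψ : E → ℝ} {c g p u v w : E} {μ μ' δ : ℝ} {n T : ℕ} {z x : ℕ → E} {ν : ℕ → ℝ}

/-- The objective of follow-the-regularized-leader (FTRL) for the accumulated gradients `c` and the
weight `μ` of the regularizer `ψ`. -/
noncomputable def ftrlObjective (ψ : E → ℝ) (c : E) (μ : ℝ) (y : E) : ℝ := ⟪c, y⟫ + μ * ψ y

/-- The optimal value of the FTRL objective; it is an infimum that need not be attained, so that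
the regret analysis needs no compactness. -/
noncomputable def ftrlValue (X : Set E) (ψ : E → ℝ) (c : E) (μ : ℝ) : ℝ :=
  ⨅ y : X, ftrlObjective ψ c μ y

/-- The drift of an FTRL step: the loss `⟪g, v⟫` of the decision `v` in excess of the growth of the
optimal value when the gradient `g` is added to the accumulated gradients `c`. -/
noncomputable def ftrlDrift (X : Set E) (ψ : E → ℝ) (c : E) (μ : ℝ) (g v : E) : ℝ :=
  ⟪g, v⟫ + ftrlValue X ψ c μ - ftrlValue X ψ (c + g) μ

lemma inner_sub_le_diam_mul_norm (hX : Bornology.IsBounded X) (hv : v ∈ X) (hw : w ∈ X) (c : E) :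
    ⟪c, v - w⟫ ≤ Metric.diam X * ‖c‖ := by
  rw [mul_comm]
  refine (real_inner_le_norm _ _).trans (mul_le_mul_of_nonneg_left ?_ (norm_nonneg c))
  rw [← dist_eq_norm]
  exact Metric.dist_le_diam_of_mem hX hv hw

lemma strongConvexOn_ftrlObjective (hψ : StrongConvexOn X 1 ψ) (hμ : 0 ≤ μ) (c : E) :
    StrongConvexOn X μ (ftrlObjective ψ c μ) := by
  refine ⟨hψ.1, fun v hv w hw a b ha hb hab => ?_⟩
  have hscaled := mul_le_mul_of_nonneg_left (hψ.2 hv hw ha hb hab) hμ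
  simp only [ftrlObjective, smul_eq_mul, inner_add_right, inner_smul_right] at hscaled ⊢
  linarith

lemma inner_sub_le_ftrlObjective (hX : Bornology.IsBounded X) (hψ : ∀ y ∈ X, 0 ≤ ψ y) (hμ : 0 ≤ μ)
    (hw : w ∈ X) (c : E) {y : E} (hy : y ∈ X) :
    ⟪c, w⟫ - Metric.diam X * ‖c‖ ≤ ftrlObjective ψ c μ y := by
  have hinner := inner_sub_le_diam_mul_norm hX hw hy c
  have hreg : 0 ≤ μ * ψ y := mul_nonneg hμ (hψ y hy)
  rw [inner_sub_right] at hinner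
  rw [ftrlObjective]
  linarith

lemma inner_sub_le_ftrlValue (hX : Bornology.IsBounded X) (hψ : ∀ y ∈ X, 0 ≤ ψ y) (hμ : 0 ≤ μ)
    (hw : w ∈ X) (c : E) : ⟪c, w⟫ - Metric.diam X * ‖c‖ ≤ ftrlValue X ψ c μ :=
  haveI : Nonempty X := ⟨⟨w, hw⟩⟩
  le_ciInf fun y => inner_sub_le_ftrlObjective hX hψ hμ hw c y.2

lemma ftrlValue_le (hX : Bornology.IsBounded X) (hψ : ∀ y ∈ X, 0 ≤ ψ y) (hμ : 0 ≤ μ)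
    (hw : w ∈ X) (c : E) : ftrlValue X ψ c μ ≤ ftrlObjective ψ c μ w := by
  refine ciInf_le (f := fun y : X => ftrlObjective ψ c μ y) ⟨⟪c, w⟫ - Metric.diam X * ‖c‖, ?_⟩
    ⟨w, hw⟩
  rintro _ ⟨y, rfl⟩
  exact inner_sub_le_ftrlObjective hX hψ hμ hw c y.2

lemma ftrlValue_mono (hX : Bornology.IsBounded X) (hψ : ∀ y ∈ X, 0 ≤ ψ y) (hne : X.Nonempty)
    (hμ : 0 ≤ μ) (hμμ' : μ ≤ μ') (c : E) : ftrlValue X ψ c μ ≤ ftrlValue X ψ c μ' :=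
  haveI := hne.to_subtype
  le_ciInf fun y => (ftrlValue_le hX hψ hμ y.2 c).trans
    (add_le_add_right (mul_le_mul_of_nonneg_right hμμ' (hψ y y.2)) _)

lemma ftrlDrift_le_of_forall_exists (hX : Bornology.IsBounded X) (hψ : ∀ y ∈ X, 0 ≤ ψ y)
    (hne : X.Nonempty) (hμ : 0 ≤ μ)
    (hδ : ∀ w ∈ X, ∃ y ∈ X, ⟪g, v⟫ + ftrlObjective ψ c μ y ≤ ftrlObjective ψ (c + g) μ w + δ) :
    ftrlDrift X ψ c μ g v ≤ δ := by
  have := hne.to_subtype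
  have hvalue : ⟪g, v⟫ + ftrlValue X ψ c μ - δ ≤ ftrlValue X ψ (c + g) μ := by
    refine le_ciInf fun w => ?_
    obtain ⟨y, hy, hle⟩ := hδ w w.2
    linarith [ftrlValue_le hX hψ hμ hy c]
  rw [ftrlDrift]
  linarith

lemma ftrlDrift_le_diam_mul_min (hX : Bornology.IsBounded X) (hψ : ∀ y ∈ X, 0 ≤ ψ y) (hμ : 0 ≤ μ)
    (hv : v ∈ X) (hmin : IsMinOn (ftrlObjective ψ (c + p) μ) X v) :
    ftrlDrift X ψ c μ g v ≤ Metric.diam X * min ‖p - g‖ ‖g‖ := by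
  rw [mul_min_of_nonneg _ _ Metric.diam_nonneg]
  refine le_min ?_ ?_ <;> refine ftrlDrift_le_of_forall_exists hX hψ ⟨v, hv⟩ hμ fun w hw => ?_
  · refine ⟨v, hv, ?_⟩
    have hle : ftrlObjective ψ (c + p) μ v ≤ ftrlObjective ψ (c + p) μ w := hmin hw
    have herr := inner_sub_le_diam_mul_norm hX hw hv (p - g)
    simp only [ftrlObjective, inner_add_left, inner_sub_left, inner_sub_right] at hle herr ⊢
    linarith
  · refine ⟨w, hw, ?_⟩
    have hgrad := inner_sub_le_diam_mul_norm hX hv hw g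
    simp only [ftrlObjective, inner_add_left, inner_sub_right] at hgrad ⊢
    linarith

lemma ftrlDrift_le_huber_div (hX : Bornology.IsBounded X) (hψ0 : ∀ y ∈ X, 0 ≤ ψ y)
    (hψ : StrongConvexOn X 1 ψ) (hμ : 0 < μ) (hv : v ∈ X)
    (hmin : IsMinOn (ftrlObjective ψ (c + p) μ) X v) :
    ftrlDrift X ψ c μ g v ≤ huber ‖p - g‖ ‖g‖ / μ := by
  obtain ⟨τ, ⟨hτ0, hτ1⟩, hclip, hhuber⟩ := exists_huber_eq (norm_nonneg (p - g)) (norm_nonneg g)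
  refine ftrlDrift_le_of_forall_exists hX hψ0 ⟨v, hv⟩ hμ.le fun w hw =>
    ⟨τ • v + (1 - τ) • w, hψ.1 hv hw hτ0 (sub_nonneg.2 hτ1) (by ring), ?_⟩
  have hconv := (strongConvexOn_ftrlObjective hψ hμ.le c).2 hv hw hτ0 (sub_nonneg.2 hτ1) (by ring)
  have hgrowth := mul_le_mul_of_nonneg_left (add_sq_norm_sub_le_of_isMinOn
    (strongConvexOn_ftrlObjective hψ hμ.le (c + p)) hv hmin hw) hτ0
  have herr : τ * ⟪p - g, w - v⟫ ≤ τ * (‖p - g‖ * ‖w - v‖) :=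
    mul_le_mul_of_nonneg_left (real_inner_le_norm _ _) hτ0
  have hgrad : (1 - τ) * ⟪g, v - w⟫ ≤ (1 - τ) * ‖g‖ * ‖w - v‖ := by
    rw [mul_assoc, norm_sub_rev w]
    exact mul_le_mul_of_nonneg_left (real_inner_le_norm _ _) (sub_nonneg.2 hτ1)
  have hquad : τ * (2 - τ) * (‖p - g‖ * ‖w - v‖ - μ / 2 * ‖w - v‖ ^ 2) ≤
      huber ‖p - g‖ ‖g‖ / μ := by
    have hsq : 0 ≤ τ * (2 - τ) * (‖p - g‖ - μ * ‖w - v‖) ^ 2 :=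
      mul_nonneg (mul_nonneg hτ0 (by linarith)) (sq_nonneg _)
    rw [hhuber, le_div_iff₀ hμ]
    linarith
  rw [hclip] at hgrad
  rw [norm_sub_rev v w] at hconv
  simp only [ftrlObjective, inner_add_left, inner_sub_left, inner_sub_right, smul_eq_mul] at *
  linarith

lemma mul_ftrlDrift_le_huber (hX : Bornology.IsBounded X) (hψ0 : ∀ y ∈ X, 0 ≤ ψ y)
    (hψ : StrongConvexOn X 1 ψ) (hμ : 0 ≤ μ) (hv : v ∈ X)
    (hmin : IsMinOn (ftrlObjective ψ (c + p) μ) X v) :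
    μ * ftrlDrift X ψ c μ g v ≤ huber ‖p - g‖ ‖g‖ := by
  rcases hμ.eq_or_lt with rfl | hμ
  · simpa using huber_nonneg (norm_nonneg (p - g)) (norm_nonneg g)
  · rw [← le_div_iff₀' hμ]
    exact ftrlDrift_le_huber_div hX hψ0 hψ hμ hv hmin

lemma sum_inner_add_ftrlValue_le (hX : Bornology.IsBounded X) (hψ : ∀ y ∈ X, 0 ≤ ψ y)
    (hne : X.Nonempty) (hν0 : ∀ t, 0 ≤ ν t) (hν : Monotone ν) (z x : ℕ → E) (hnT : n ≤ T) :
    ∑ t ∈ Icc (n + 1) T, ⟪z t, x t⟫ + ftrlValue X ψ (∑ s ∈ Icc 1 n, z s) (ν n) ≤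
      ftrlValue X ψ (∑ s ∈ Icc 1 T, z s) (ν T) +
        ∑ t ∈ Icc (n + 1) T, ftrlDrift X ψ (∑ s ∈ Icc 1 (t - 1), z s) (ν t) (z t) (x t) := by
  induction T, hnT using Nat.le_induction with
  | base => simp
  | succ T hnT ih =>
    have hmono := ftrlValue_mono hX hψ hne (hν0 T) (hν T.le_succ) (∑ s ∈ Icc 1 T, z s)
    rw [sum_Icc_succ_top (by omega), sum_Icc_succ_top (b := T) (by omega) z,
      sum_Icc_succ_top (by omega) fun t => ftrlDrift X ψ (∑ s ∈ Icc 1 (t - 1), z s) _ _ _,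
      ftrlDrift, Nat.add_sub_cancel]
    linarith

lemma sum_Icc_one_add_sum_Icc {M : Type*} [AddCommMonoid M] (f : ℕ → M) (hnT : n ≤ T) :
    ∑ s ∈ Icc 1 n, f s + ∑ s ∈ Icc (n + 1) T, f s = ∑ s ∈ Icc 1 T, f s := by
  have hIcc : ∀ k, Icc (k + 1) T = Ioc k T := fun k => Icc_add_one_left_eq_Ioc k T
  rw [hIcc, hIcc 0]
  exact sum_Ioc_consecutive f n.zero_le hnT

theorem sum_inner_sub_le_sum_ftrlDrift (hX : Bornology.IsBounded X) (hψ : ∀ y ∈ X, 0 ≤ ψ y)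
    (hν0 : ∀ t, 0 ≤ ν t) (hν : Monotone ν) (hnT : n ≤ T) (hx : ∀ t ≤ n, x t ∈ X) (hu : u ∈ X) :
    ∑ s ∈ Icc 1 T, ⟪z s, x s - u⟫ ≤
      ν T * ψ u +
        ∑ t ∈ Icc (n + 1) T, ftrlDrift X ψ (∑ s ∈ Icc 1 (t - 1), z s) (ν t) (z t) (x t) +
        2 * Metric.diam X * ∑ s ∈ Icc 1 n, ‖z s‖ := by
  have htelescope := sum_inner_add_ftrlValue_le hX hψ ⟨u, hu⟩ hν0 hν z x hnT
  have hfinal := ftrlValue_le hX hψ (hν0 T) hu (∑ s ∈ Icc 1 T, z s)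
  have hinit := inner_sub_le_ftrlValue hX hψ (hν0 n) hu (∑ s ∈ Icc 1 n, z s)
  have hnorm := mul_le_mul_of_nonneg_left (norm_sum_le (Icc 1 n) z) (Metric.diam_nonneg (s := X))
  have hhistory : ∑ s ∈ Icc 1 n, ⟪z s, x s - u⟫ ≤ Metric.diam X * ∑ s ∈ Icc 1 n, ‖z s‖ := by
    rw [mul_sum]
    exact sum_le_sum fun s hs =>
      inner_sub_le_diam_mul_norm hX (hx s (mem_Icc.1 hs).2) hu (z s)
  have hsplit := sum_Icc_one_add_sum_Icc (fun s => ⟪z s, x s⟫) hnT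
  rw [ftrlObjective] at hfinal
  simp only [inner_sub_right, sum_sub_distrib, ← sum_inner] at hhistory ⊢
  linarith

end FTRL

/-! ### Delayed gradients -/

section Delay

/-- The largest sum of `a` over a window of `m` consecutive rounds ending in a round `j ≤ n`. -/
noncomputable def maxWindow (m : ℕ) (a : ℕ → ℝ) (n : ℕ) : ℝ :=
  (range (n + 1)).sup' nonempty_range_add_one fun j => ∑ k ∈ Icc (j + 1 - m) j, a k

/-- The quantity `2 max_{j < t} a_{j-m+1:j} + √(∑_{i=1}^{t} (a_i² + 2 α b_i))`, which bounds the sum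
of the drifts up to round `t`; the adaptive weights of the regularizer are `1 / α` times it. -/
noncomputable def delayedBound (m : ℕ) (α : ℝ) (a b : ℕ → ℝ) (t : ℕ) : ℝ :=
  2 * maxWindow m a (t - 1) + √(∑ i ∈ Icc 1 t, (a i ^ 2 + 2 * α * b i))

variable {m n T : ℕ} {α B Δ x M S : ℝ} {a b e δ : ℕ → ℝ}

lemma sum_window_le_maxWindow {j : ℕ} (hj : j ≤ n) :
    ∑ k ∈ Icc (j + 1 - m) j, a k ≤ maxWindow m a n :=
  le_sup' (fun j => ∑ k ∈ Icc (j + 1 - m) j, a k) (mem_range_succ_iff.2 hj)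

lemma maxWindow_mono (m : ℕ) (a : ℕ → ℝ) : Monotone (maxWindow m a) := fun _ _ hst =>
  sup'_mono _ (range_mono (Nat.succ_le_succ hst)) _

lemma maxWindow_nonneg (ha : ∀ k, 0 ≤ a k) (m n : ℕ) : 0 ≤ maxWindow m a n :=
  (sum_nonneg fun k _ => ha k).trans (sum_window_le_maxWindow n.zero_le)

lemma maxWindow_le (hB : 0 ≤ B) (ha : ∀ k ≤ n, a k ≤ B) : maxWindow m a n ≤ m * B := by
  refine sup'_le _ _ fun j hj => sum_le_mul_of_card_le ?_ hB fun k hk =>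
    ha k ((mem_Icc.1 hk).2.trans (mem_range_succ_iff.1 hj))
  rw [Nat.card_Icc]
  omega

lemma delayedBound_mono (hα : 0 ≤ α) (hb : ∀ t, 0 ≤ b t) : Monotone (delayedBound m α a b) := by
  intro s t hst
  have hwindow := maxWindow_mono m a (Nat.sub_le_sub_right hst 1)
  have hsum : ∑ i ∈ Icc 1 s, (a i ^ 2 + 2 * α * b i) ≤ ∑ i ∈ Icc 1 t, (a i ^ 2 + 2 * α * b i) := by
    refine sum_le_sum_of_subset_of_nonneg (Icc_subset_Icc_right hst) fun i _ _ => ?_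
    have := hb i
    positivity
  rw [delayedBound, delayedBound]
  gcongr

lemma delayedBound_nonneg (ha : ∀ t, 0 ≤ a t) (t : ℕ) : 0 ≤ delayedBound m α a b t :=
  add_nonneg (mul_nonneg zero_le_two (maxWindow_nonneg ha m _)) (Real.sqrt_nonneg _)

lemma delayedBound_le (hα : 0 ≤ α) (hΔ : 0 ≤ Δ) (ha0 : ∀ t, 0 ≤ a t) (ha : ∀ t, a t ≤ Δ * e t)
    (hb : ∀ t, b t ≤ e t ^ 2 / 2) :
    delayedBound m α a b T ≤ (2 * m * Δ + √(Δ ^ 2 + α)) * √(∑ t ∈ range (T + 1), e t ^ 2) := by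
  have he : ∀ t ≤ T, e t ≤ √(∑ t ∈ range (T + 1), e t ^ 2) := fun t ht =>
    Real.le_sqrt_of_sq_le (single_le_sum (f := fun t => e t ^ 2) (fun _ _ => sq_nonneg _)
      (mem_range_succ_iff.2 ht))
  have hwindow : maxWindow m a (T - 1) ≤ m * (Δ * √(∑ t ∈ range (T + 1), e t ^ 2)) :=
    maxWindow_le (by positivity) fun k hk =>
      (ha k).trans (mul_le_mul_of_nonneg_left (he k (by omega)) hΔ)
  have hterm : ∀ t, a t ^ 2 + 2 * α * b t ≤ (Δ ^ 2 + α) * e t ^ 2 := fun t => by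
    have hsq := pow_le_pow_left₀ (ha0 t) (ha t) 2
    have hhuber := mul_le_mul_of_nonneg_left (hb t) hα
    rw [mul_pow] at hsq
    linarith
  have hsqrt : √(∑ t ∈ Icc 1 T, (a t ^ 2 + 2 * α * b t)) ≤
      √(Δ ^ 2 + α) * √(∑ t ∈ range (T + 1), e t ^ 2) := by
    rw [← Real.sqrt_mul (by positivity), mul_sum]
    refine Real.sqrt_le_sqrt ((sum_le_sum fun t _ => hterm t).trans ?_)
    refine sum_le_sum_of_subset_of_nonneg (fun t ht => ?_) fun _ _ _ => by positivity
    exact mem_range_succ_iff.2 (mem_Icc.1 ht).2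
  rw [delayedBound]
  linarith

lemma le_two_mul_add_sqrt (hM : 0 ≤ M) (h : x ^ 2 ≤ S + 2 * M * x) : x ≤ 2 * M + √S := by
  have hsq : (x - M) ^ 2 ≤ (M + √S) ^ 2 := by
    have hS : S ≤ √S ^ 2 := (le_max_left S 0).trans_eq Real.sq_sqrt'.symm
    have hcross : 0 ≤ M * √S := by positivity
    linarith
  linarith [abs_le_of_sq_le_sq' hsq (by positivity)]

lemma sum_Icc_one_sub_le_window (hδ0 : ∀ t, 0 ≤ δ t) (hδa : ∀ t, δ t ≤ a t) (n : ℕ) :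
    ∑ s ∈ Icc 1 n, δ s - ∑ s ∈ Icc 1 (n - m), δ s ≤ ∑ s ∈ Icc (n + 1 - m) n, a s := by
  rw [← sum_Icc_one_add_sum_Icc δ (n.sub_le m), add_sub_cancel_left]
  refine (sum_le_sum fun s _ => hδa s).trans ?_
  refine sum_le_sum_of_subset_of_nonneg (Icc_subset_Icc_left (by omega)) fun s _ _ => ?_
  exact (hδ0 s).trans (hδa s)

lemma sq_sum_le_sum_add_mul_sum (hδ0 : ∀ t, 0 ≤ δ t) (hδa : ∀ t, δ t ≤ a t)
    (hwindow : ∀ n < T, ∑ s ∈ Icc 1 n, δ s - ∑ s ∈ Icc 1 (n - m), δ s ≤ M)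
    (hδb : ∀ n < T, δ (n + 1) * ∑ s ∈ Icc 1 (n - m), δ s ≤ α * b (n + 1)) :
    (∑ s ∈ Icc 1 T, δ s) ^ 2 ≤
      ∑ i ∈ Icc 1 T, (a i ^ 2 + 2 * α * b i) + 2 * M * ∑ s ∈ Icc 1 T, δ s := by
  induction T with
  | zero => simp
  | succ T ih =>
    have hprev := ih (fun n hn => hwindow n (by omega)) fun n hn => hδb n (by omega)
    have hdelay := hδb T T.lt_succ_self
    have hlast := mul_le_mul_of_nonneg_left (hwindow T T.lt_succ_self) (hδ0 (T + 1))
    have hsq := pow_le_pow_left₀ (hδ0 (T + 1)) (hδa (T + 1)) 2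
    simp only [sum_Icc_succ_top (Nat.le_add_left 1 T)]
    linarith

/-- Strong induction: each drift is compared with the bound for the sum of the drifts up to
round `t - 1 - m`, and the drifts of the `m` rounds in between lie in a single window. -/
lemma sum_le_delayedBound (hα : 0 ≤ α) (hδ0 : ∀ t, 0 ≤ δ t) (hδa : ∀ t, δ t ≤ a t)
    (hb : ∀ t, 0 ≤ b t)
    (hδb : ∀ t, m + 2 ≤ t → t ≤ T → δ t * delayedBound m α a b (t - 1 - m) ≤ α * b t) :
    ∀ t ≤ T, ∑ s ∈ Icc 1 t, δ s ≤ delayedBound m α a b t := by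
  intro t
  induction t using Nat.strong_induction_on with
  | _ t ih =>
  intro htT
  refine le_two_mul_add_sqrt (maxWindow_nonneg (fun k => (hδ0 k).trans (hδa k)) m (t - 1))
    (sq_sum_le_sum_add_mul_sum (m := m) hδ0 hδa (fun n hn => ?_) fun n hn => ?_)
  · exact (sum_Icc_one_sub_le_window hδ0 hδa n).trans (sum_window_le_maxWindow (by omega))
  · rcases le_or_gt n m with hnm | hnm
    · simpa [Nat.sub_eq_zero_of_le hnm] using mul_nonneg hα (hb (n + 1))
    · refine (mul_le_mul_of_nonneg_left (ih (n - m) (by omega) (by omega)) (hδ0 (n + 1))).trans ?_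
      simpa using hδb (n + 1) (by omega) (by omega)

lemma sum_Icc_add_two_le_delayedBound (hα : 0 ≤ α) (ha : ∀ t, 0 ≤ a t) (hb : ∀ t, 0 ≤ b t)
    (hδa : ∀ t, m + 2 ≤ t → t ≤ T → δ t ≤ a t)
    (hδb : ∀ t, m + 2 ≤ t → t ≤ T → δ t * delayedBound m α a b (t - 1 - m) ≤ α * b t) :
    ∑ t ∈ Icc (m + 2) T, δ t ≤ delayedBound m α a b T := by
  set η : ℕ → ℝ := fun t => if m + 2 ≤ t ∧ t ≤ T then max (δ t) 0 else 0
  have hη : ∀ t, m + 2 ≤ t → t ≤ T → η t = max (δ t) 0 := fun t hmt htT => if_pos ⟨hmt, htT⟩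
  have hη0 : ∀ t, 0 ≤ η t := fun t => by positivity
  have hηa : ∀ t, η t ≤ a t := fun t => by
    by_cases ht : m + 2 ≤ t ∧ t ≤ T
    · rw [hη t ht.1 ht.2]
      exact max_le (hδa t ht.1 ht.2) (ha t)
    · exact (if_neg ht).trans_le (ha t)
  have hηb : ∀ t, m + 2 ≤ t → t ≤ T → η t * delayedBound m α a b (t - 1 - m) ≤ α * b t := by
    intro t hmt htT
    rw [hη t hmt htT, max_mul_of_nonneg _ _ (delayedBound_nonneg ha _), zero_mul]
    exact max_le (hδb t hmt htT) (mul_nonneg hα (hb t))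
  calc ∑ t ∈ Icc (m + 2) T, δ t
      ≤ ∑ t ∈ Icc (m + 2) T, η t := sum_le_sum fun t ht => by
        rw [hη t (mem_Icc.1 ht).1 (mem_Icc.1 ht).2]
        exact le_max_left _ _
    _ ≤ ∑ t ∈ Icc 1 T, η t :=
        sum_le_sum_of_subset_of_nonneg (Icc_subset_Icc_left (by omega)) fun t _ _ => hη0 t
    _ ≤ delayedBound m α a b T := sum_le_delayedBound hα hη0 hηa hb hηb T le_rfl

end Delay

section DelayedFTRL

variable {E : Type*} [NormedAddCommGroup E] {X : Set E} {ψ : E → ℝ} {m T t : ℕ}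
  {α ρ : ℝ} {z h x : ℕ → E} {ν : ℕ → ℝ} {u : E}

/-- The error of the hint `h t` as an estimate of the gradients `z (t - m), …, z t`, which are the
ones that are not known when the decision of round `t` is made. -/
noncomputable def delayErr (m : ℕ) (z h : ℕ → E) (t : ℕ) : ℝ :=
  ‖h t - ∑ s ∈ Icc (t - m) t, z s‖

/-- The sequence `a_t = diam X · min(e_t, ‖z_t‖)`, where `e_t` is the error of the hint. -/
noncomputable def driftCap (X : Set E) (m : ℕ) (z h : ℕ → E) (t : ℕ) : ℝ :=
  Metric.diam X * min (delayErr m z h t) ‖z t‖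

/-- The sequence `b_t = huber(e_t, ‖z_t‖)`, where `e_t` is the error of the hint. -/
noncomputable def huberCap (m : ℕ) (z h : ℕ → E) (t : ℕ) : ℝ :=
  huber (delayErr m z h t) ‖z t‖

/-- The bound `delayedBound` on the sum of the drifts of delayed FTRL, which bounds each of them by
`driftCap` and, times the weight of the regularizer, by `huberCap`. -/
noncomputable def ftrlBound (X : Set E) (m : ℕ) (α : ℝ) (z h : ℕ → E) : ℕ → ℝ :=
  delayedBound m α (driftCap X m z h) (huberCap m z h)

lemma driftCap_nonneg (t : ℕ) : 0 ≤ driftCap X m z h t :=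
  mul_nonneg Metric.diam_nonneg (le_min (norm_nonneg _) (norm_nonneg _))

lemma huberCap_nonneg (t : ℕ) : 0 ≤ huberCap m z h t :=
  huber_nonneg (norm_nonneg _) (norm_nonneg _)

lemma ftrlBound_mono (hα : 0 ≤ α) : Monotone (ftrlBound X m α z h) :=
  delayedBound_mono hα huberCap_nonneg

lemma ftrlBound_nonneg (t : ℕ) : 0 ≤ ftrlBound X m α z h t :=
  delayedBound_nonneg driftCap_nonneg t

lemma ftrlBound_le (hα : 0 ≤ α) :
    ftrlBound X m α z h T ≤ (2 * m * Metric.diam X + √(Metric.diam X ^ 2 + α)) *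
      √(∑ t ∈ range (T + 1), delayErr m z h t ^ 2) :=
  delayedBound_le hα Metric.diam_nonneg driftCap_nonneg
    (fun _ => mul_le_mul_of_nonneg_left (min_le_left _ _) Metric.diam_nonneg)
    fun _ => huber_le _ _

variable [InnerProductSpace ℝ E]

/-- The decisions `x` are those of FTRL on `X` with gradients `z` that are delayed by `m` rounds,
hints `h`, regularizer `ψ` and weights `ν`, up to round `T` and with an arbitrary history up to
round `m + 1`. -/
structure IsDelayedFTRL (X : Set E) (ψ : E → ℝ) (m T : ℕ) (z h : ℕ → E) (ν : ℕ → ℝ)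
    (x : ℕ → E) : Prop where
  mem : ∀ t ≤ T, x t ∈ X
  isMinOn : ∀ t, m + 2 ≤ t → t ≤ T →
    IsMinOn (ftrlObjective ψ (∑ s ∈ Icc 1 (t - 1 - m), z s + h t) (ν t)) X (x t)

namespace IsDelayedFTRL

lemma exists_isMinOn_of_delayErr (H : IsDelayedFTRL X ψ m T z h ν x) (hmt : m + 2 ≤ t)
    (htT : t ≤ T) :
    ∃ p, ‖p - z t‖ = delayErr m z h t ∧
      IsMinOn (ftrlObjective ψ (∑ s ∈ Icc 1 (t - 1), z s + p) (ν t)) X (x t) := by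
  obtain ⟨n, rfl⟩ : ∃ n, t = n + 1 := ⟨t - 1, by omega⟩
  have hdelayed : n - m + 1 = n + 1 - m := by omega
  have hmin := H.isMinOn (n + 1) hmt htT
  rw [Nat.add_sub_cancel] at hmin ⊢
  refine ⟨h (n + 1) - ∑ s ∈ Icc (n + 1 - m) n, z s, ?_, ?_⟩
  · rw [delayErr, sum_Icc_succ_top (by omega), sub_sub]
  · rwa [← sum_Icc_one_add_sum_Icc z (n.sub_le m), hdelayed, add_add_sub_cancel]

lemma ftrlDrift_le (H : IsDelayedFTRL X ψ m T z h ν x) (hX : Bornology.IsBounded X)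
    (hψ : ∀ y ∈ X, 0 ≤ ψ y) (hν : 0 ≤ ν t) (hmt : m + 2 ≤ t) (htT : t ≤ T) :
    ftrlDrift X ψ (∑ s ∈ Icc 1 (t - 1), z s) (ν t) (z t) (x t) ≤
      driftCap X m z h t := by
  obtain ⟨p, hp, hmin⟩ := H.exists_isMinOn_of_delayErr hmt htT
  rw [driftCap, ← hp]
  exact ftrlDrift_le_diam_mul_min hX hψ hν (H.mem t htT) hmin

lemma mul_ftrlDrift_le (H : IsDelayedFTRL X ψ m T z h ν x) (hX : Bornology.IsBounded X)
    (hψ0 : ∀ y ∈ X, 0 ≤ ψ y) (hψ : StrongConvexOn X 1 ψ) (hν : 0 ≤ ν t) (hmt : m + 2 ≤ t)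
    (htT : t ≤ T) :
    ν t * ftrlDrift X ψ (∑ s ∈ Icc 1 (t - 1), z s) (ν t) (z t) (x t) ≤
      huberCap m z h t := by
  obtain ⟨p, hp, hmin⟩ := H.exists_isMinOn_of_delayErr hmt htT
  rw [huberCap, ← hp]
  exact mul_ftrlDrift_le_huber hX hψ0 hψ hν (H.mem t htT) hmin

lemma sum_ftrlDrift_le (H : IsDelayedFTRL X ψ m T z h ν x) (hX : Bornology.IsBounded X)
    (hψ0 : ∀ y ∈ X, 0 ≤ ψ y) (hψ : StrongConvexOn X 1 ψ) (hα : 0 < α)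
    (hν : ∀ t, ν t = ftrlBound X m α z h (t - 1 - m) / α) :
    ∑ t ∈ Icc (m + 2) T, ftrlDrift X ψ (∑ s ∈ Icc 1 (t - 1), z s) (ν t) (z t) (x t) ≤
      ftrlBound X m α z h T := by
  have hν0 : ∀ t, 0 ≤ ν t := fun t => by
    rw [hν]
    exact div_nonneg (ftrlBound_nonneg _) hα.le
  refine sum_Icc_add_two_le_delayedBound hα.le driftCap_nonneg huberCap_nonneg
    (fun t => H.ftrlDrift_le hX hψ0 (hν0 t)) fun t hmt htT => ?_
  have hmul : α * ν t = ftrlBound X m α z h (t - 1 - m) := by rw [hν, mul_div_cancel₀ _ hα.ne']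
  rw [← ftrlBound, ← hmul, mul_comm, mul_assoc]
  exact mul_le_mul_of_nonneg_left (H.mul_ftrlDrift_le hX hψ0 hψ (hν0 t) hmt htT) hα.le

theorem sum_inner_sub_le (H : IsDelayedFTRL X ψ m T z h ν x) (hX : Bornology.IsBounded X)
    (hψ0 : ∀ y ∈ X, 0 ≤ ψ y) (hψρ : ∀ y ∈ X, ψ y ≤ ρ) (hψ : StrongConvexOn X 1 ψ) (hα : 0 < α)
    (hν : ∀ t, ν t = ftrlBound X m α z h (t - 1 - m) / α) (hu : u ∈ X) :
    ∑ s ∈ Icc 1 T, ⟪z s, x s - u⟫ ≤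
      (ρ / α + 1) * ((2 * m * Metric.diam X + √(Metric.diam X ^ 2 + α)) *
        √(∑ t ∈ range (T + 1), delayErr m z h t ^ 2)) +
      2 * Metric.diam X * ∑ s ∈ Icc 1 (min T (m + 1)), ‖z s‖ := by
  have hρ : 0 ≤ ρ := (hψ0 u hu).trans (hψρ u hu)
  have hmono := ftrlBound_mono (X := X) (m := m) (z := z) (h := h) hα.le
  have hν0 : ∀ t, 0 ≤ ν t := fun t => by
    rw [hν]
    exact div_nonneg (ftrlBound_nonneg _) hα.le
  have hνmono : Monotone ν := fun s t hst => by
    rw [hν, hν]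
    exact div_le_div_of_nonneg_right (hmono (by omega)) hα.le
  have hregularizer : ν T * ψ u ≤ ρ / α * ftrlBound X m α z h T := by
    rw [div_mul_comm]
    refine mul_le_mul ?_ (hψρ u hu) (hψ0 u hu) (div_nonneg (ftrlBound_nonneg _) hα.le)
    rw [hν]
    exact div_le_div_of_nonneg_right (hmono (by omega)) hα.le
  have hregret := sum_inner_sub_le_sum_ftrlDrift (z := z) hX hψ0 hν0 hνmono
    (min_le_left T (m + 1)) (fun t ht => H.mem t (by omega)) hu
  have hfree : Icc (min T (m + 1) + 1) T = Icc (m + 2) T := by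
    ext t
    simp only [mem_Icc]
    omega
  have hdrifts := H.sum_ftrlDrift_le hX hψ0 hψ hα hν
  have hbound := mul_le_mul_of_nonneg_left
    (ftrlBound_le (X := X) (m := m) (T := T) (z := z) (h := h) hα.le)
    (by positivity : 0 ≤ ρ / α + 1)
  rw [hfree] at hregret
  linarith

end IsDelayedFTRL

end DelayedFTRL

/-! ### Linear functions with memory -/

section LinearFunctions

variable {d m : ℕ} {φ : ℕ → LinFun d} {v x : Space d} {L : ℝ} {K : NNReal}

lemma LinFun.eval_sub (φ : LinFun d) (x y : Space d) :
    φ.eval x - φ.eval y = ⟪φ.slope, x - y⟫ := by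
  rw [LinFun.eval, LinFun.eval, inner_sub_right, add_sub_add_right_eq_sub]

lemma LinFun.lipschitzWith_eval (φ : LinFun d) : LipschitzWith ‖φ.slope‖₊ φ.eval :=
  LipschitzWith.of_dist_le_mul fun x y => by
    rw [Real.dist_eq, φ.eval_sub, dist_eq_norm]
    exact abs_real_inner_le_norm _ _

lemma norm_slope_le_of_memVal_lipschitz (hL : 0 ≤ L)
    (h : ∀ y z : ℕ → Space d, |memVal m φ y - memVal m φ z| ≤
      L * √(∑ i ∈ range (m + 1), ‖y i - z i‖ ^ 2)) {i : ℕ} (hi : i ≤ m) :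
    ‖(φ i).slope‖ ≤ L := by
  have hsingle := h (Pi.single i (φ i).slope) 0
  have hvalue : memVal m φ (Pi.single i (φ i).slope) - memVal m φ 0 = ‖(φ i).slope‖ ^ 2 := by
    simp [memVal, ← sum_sub_distrib, LinFun.eval_sub, Pi.single_apply, hi,
      apply_ite (inner ℝ _)]
  have hnorm : ∑ j ∈ range (m + 1),
      ‖Pi.single (M := fun _ => Space d) i (φ i).slope j - (0 : ℕ → Space d) j‖ ^ 2 =
        ‖(φ i).slope‖ ^ 2 := by
    simp [Pi.single_apply, hi, apply_ite norm]
  rw [hvalue, hnorm, Real.sqrt_sq (norm_nonneg _), abs_of_nonneg (sq_nonneg _)] at hsingle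
  exact le_of_sq_le_mul hL hsingle

lemma IsSubgradientAt.norm_le {φ : Space d → ℝ} (hφ : LipschitzWith K φ)
    (h : IsSubgradientAt φ v x) : ‖v‖ ≤ K := by
  have hsub := h (x + v)
  have hlip := (le_abs_self _).trans (hφ.dist_le_mul (x + v) x)
  rw [dist_eq_norm] at hlip
  rw [add_sub_cancel_left] at hsub hlip
  rw [real_inner_self_eq_norm_sq] at hsub
  exact le_of_sq_le_mul K.2 (by linarith)

end LinearFunctions

namespace Problem

variable {d : ℕ} {P : Problem d} {F G Lf Lg : ℝ} {x : ℕ → Space d} {t i : ℕ}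

lemma Assumptions.norm_slope_f_le (hP : P.Assumptions F G Lf Lg) (hL : 0 ≤ Lf) (t : ℕ)
    (hi : i ≤ P.m) : ‖(P.f t i).slope‖ ≤ Lf := by
  by_cases ht : t ≤ P.m ∨ P.T < t
  · simpa [hP.f_zero t ht i] using hL
  · exact norm_slope_le_of_memVal_lipschitz hL (hP.f_lip t (mem_Icc.2 (by omega))) hi

lemma Assumptions.norm_slope_g_le (hP : P.Assumptions F G Lf Lg) (hL : 0 ≤ Lg) (t : ℕ)
    (hi : i ≤ P.m) : ‖(P.g t i).slope‖ ≤ Lg := by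
  by_cases ht : t ≤ P.m ∨ P.T < t
  · simpa [hP.g_zero t ht i] using hL
  · exact norm_slope_le_of_memVal_lipschitz hL (hP.g_lip t (mem_Icc.2 (by omega))) hi

lemma violation_mono (P : Problem d) (x : ℕ → Space d) : Monotone (P.violation x) :=
  fun _ _ h => sum_le_sum_of_subset_of_nonneg (Icc_subset_Icc_right h)
    fun _ _ _ => le_max_right _ _

lemma violation_nonneg (P : Problem d) (x : ℕ → Space d) (t : ℕ) : 0 ≤ P.violation x t :=
  sum_nonneg fun _ _ => le_max_right _ _

lemma violation_succ (P : Problem d) (x : ℕ → Space d) (ht : P.m ≤ t + 1) :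
    P.violation x (t + 1) = P.violation x t + max (P.constrAt x (t + 1)) 0 :=
  sum_Icc_succ_top ht _

lemma Assumptions.violation_eq_zero (hP : P.Assumptions F G Lf Lg) (x : ℕ → Space d)
    (ht : t ≤ P.m) : P.violation x t = 0 :=
  sum_eq_zero fun k hk => by
    simp [constrAt, memVal, LinFun.eval, hP.g_zero k (Or.inl ((mem_Icc.1 hk).2.trans ht))]

lemma Assumptions.violation_le_pred_add (hP : P.Assumptions F G Lf Lg) (hG : 0 ≤ G)
    (hx : ∀ t ≤ P.T, x t ∈ P.X) (ht : t ≤ P.T) :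
    P.violation x t ≤ P.violation x (t - 1) + G := by
  rcases t with - | t
  · simpa using hG
  · rcases lt_or_ge (t + 1) P.m with htm | hmt
    · rw [hP.violation_eq_zero x htm.le]
      exact add_nonneg (P.violation_nonneg x t) hG
    · rw [P.violation_succ x hmt, Nat.add_sub_cancel]
      have hbound := hP.g_bdd (t + 1) (mem_Icc.2 ⟨hmt, ht⟩) (fun i => x (t + 1 - i))
        fun i _ => hx _ (by omega)
      exact add_le_add_right (max_le ((le_abs_self _).trans hbound) hG) _

lemma Assumptions.violation_le_sub_add (hP : P.Assumptions F G Lf Lg) (hG : 0 ≤ G)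
    (hx : ∀ t ≤ P.T, x t ∈ P.X) (ht : t ≤ P.T) (n : ℕ) :
    P.violation x t ≤ P.violation x (t - n) + n * G := by
  induction n with
  | zero => simp
  | succ n ih =>
    have hstep := hP.violation_le_pred_add hG hx ((t.sub_le n).trans ht)
    rw [Nat.sub_sub] at hstep
    push_cast
    linarith

lemma Assumptions.abs_sum_lossAt_le (hP : P.Assumptions F G Lf Lg) (hF : 0 ≤ F)
    (hx : ∀ t ≤ P.T, x t ∈ P.X) : |∑ t ∈ Icc P.m P.T, P.lossAt x t| ≤ F * (P.T + 1) := by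
  have hcard : #(Icc P.m P.T) ≤ P.T + 1 := by
    rw [Nat.card_Icc]
    omega
  have hsum := norm_sum_le_mul_of_card_le (f := P.lossAt x) hcard hF fun t ht =>
    hP.f_bdd t ht (fun i => x (t - i)) fun i _ =>
      hx _ ((t.sub_le i).trans (mem_Icc.1 ht).2)
  rw [Real.norm_eq_abs] at hsum
  push_cast at hsum
  linarith

lemma Assumptions.neg_le_regret (hP : P.Assumptions F G Lf Lg) (hF : 0 ≤ F)
    (hx : ∀ t ≤ P.T, x t ∈ P.X) (hne : P.benchmark.Nonempty) :
    -(2 * F * (P.T + 1)) ≤ P.regret x := by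
  have hcomparator : ∀ u ∈ P.benchmark,
      |∑ t ∈ Icc P.m P.T, P.lossAt (fun _ => u) t| ≤ F * (P.T + 1) :=
    fun u hu => hP.abs_sum_lossAt_le hF fun _ _ => hu.1
  have hbdd : BddBelow
      ((fun u => ∑ t ∈ Icc P.m P.T, P.lossAt (fun _ => u) t) '' P.benchmark) := by
    refine ⟨-(F * (P.T + 1)), ?_⟩
    rintro _ ⟨u, hu, rfl⟩
    exact (abs_le.1 (hcomparator u hu)).1
  obtain ⟨u, hu⟩ := hne
  have hinf := (csInf_le hbdd (Set.mem_image_of_mem _ hu)).trans (abs_le.1 (hcomparator u hu)).2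
  have hloss := (abs_le.1 (hP.abs_sum_lossAt_le hF hx)).1
  rw [regret]
  linarith

end Problem

/-! ### Prediction errors -/

section WeightedSums

variable {E : Type*} [NormedAddCommGroup E] {m t : ℕ} {B : ℝ}

/-- Summation by parts: every increment of the weight multiplies a tail of the sum. -/
lemma norm_sum_monotone_smul_le [NormedSpace ℝ E] {ι : Type*} {S : Finset ι} {κ : ι → ℕ}
    {w : ℕ → ℝ} (hw : Monotone w) (hw0 : 0 ≤ w 0) {D : ι → E}
    (htail : ∀ j ≤ m, ‖∑ p ∈ S with j ≤ κ p, D p‖ ≤ B) :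
    ‖∑ p ∈ S, w (min (κ p) m) • D p‖ ≤ w m * B := by
  induction m with
  | zero =>
    have hall := htail 0 le_rfl
    simp only [zero_le, filter_true] at hall
    simp only [Nat.min_zero, ← smul_sum, norm_smul, Real.norm_of_nonneg hw0]
    gcongr
  | succ m ih =>
    have hincr : 0 ≤ w (m + 1) - w m := sub_nonneg.2 (hw m.le_succ)
    have hsplit : ∑ p ∈ S, w (min (κ p) (m + 1)) • D p = ∑ p ∈ S, w (min (κ p) m) • D p +
        (w (m + 1) - w m) • ∑ p ∈ S with m + 1 ≤ κ p, D p := by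
      rw [smul_sum, sum_filter, ← sum_add_distrib]
      refine sum_congr rfl fun p _ => ?_
      split_ifs with hp
      · rw [min_eq_right hp, min_eq_right (by omega), ← add_smul, add_sub_cancel]
      · rw [min_eq_left (by omega), min_eq_left (by omega), add_zero]
    calc ‖∑ p ∈ S, w (min (κ p) (m + 1)) • D p‖
        ≤ w m * B + (w (m + 1) - w m) * B := by
          rw [hsplit]
          refine norm_add_le_of_le (ih fun j hj => htail j (by omega)) ?_
          rw [norm_smul, Real.norm_of_nonneg hincr]
          exact mul_le_mul_of_nonneg_left (htail (m + 1) le_rfl) hincr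
      _ = w (m + 1) * B := by ring

lemma norm_sum_sum_monotone_smul_le [NormedSpace ℝ E] {w : ℕ → ℝ} (hw : Monotone w)
    (hw0 : ∀ k, 0 ≤ w k) {D : ℕ → ℕ → E}
    (htail : ∀ j ≤ m, ‖∑ s ∈ Icc (t - m) t, ∑ i ∈ Icc (t + j - s) m, D s i‖ ≤ B) :
    ‖∑ s ∈ Icc (t - m) t, ∑ i ∈ Icc (t - s) m, w (s + i) • D s i‖ ≤ w (t + m) * B := by
  have hle := norm_sum_monotone_smul_le (S := (Icc (t - m) t).sigma fun s => Icc (t - s) m)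
    (κ := fun p => p.1 + p.2 - t) (w := fun j => w (t + j)) (D := fun p => D p.1 p.2) (m := m)
    (B := B) (fun j k hjk => hw (by omega)) (hw0 _) fun j hj => ?_
  · rw [sum_sigma] at hle
    convert hle using 5 with s hs i hi
    have := mem_Icc.1 hs
    have := mem_Icc.1 hi
    refine congrArg w ?_
    dsimp only
    omega
  · convert htail j hj using 2
    rw [sum_filter, sum_sigma]
    refine sum_congr rfl fun s hs => ?_
    rw [← sum_filter]
    refine sum_congr ?_ fun _ _ => rfl
    ext i
    have := mem_Icc.1 hs
    simp only [mem_filter, mem_Icc]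
    omega

lemma norm_sum_sum_le {D : ℕ → ℕ → E} {l : ℕ → ℕ} (hB : 0 ≤ B)
    (h : ∀ s ≤ t, ∀ i ≤ m, ‖D s i‖ ≤ B) :
    ‖∑ s ∈ Icc (t - m) t, ∑ i ∈ Icc (l s) m, D s i‖ ≤ (m + 1) ^ 2 * B := by
  have hinner : ∀ s ∈ Icc (t - m) t, ‖∑ i ∈ Icc (l s) m, D s i‖ ≤ ↑(m + 1) * B := fun s hs =>
    norm_sum_le_mul_of_card_le (by rw [Nat.card_Icc]; omega) hB fun i hi =>
      h s (mem_Icc.1 hs).2 i (mem_Icc.1 hi).2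
  have houter := norm_sum_le_mul_of_card_le (n := m + 1) (by rw [Nat.card_Icc]; omega)
    (by positivity) hinner
  push_cast at houter
  linarith

end WeightedSums

namespace Run

variable {d : ℕ} {R : Run d} {P : Problem d} {F G Lf Lg ρ : ℝ} {k s t i j : ℕ}

lemma weight_eq (R : Run d) (P : Problem d) (k : ℕ) :
    R.weight P k = R.lam * Real.exp (R.lam * P.violation R.x (k - P.m - 1)) := by
  have hderiv : HasDerivAt (penalty R.lam)
      (Real.exp (R.lam * P.violation R.x (k - P.m - 1)) * (R.lam * 1))
      (P.violation R.x (k - P.m - 1)) :=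
    (((hasDerivAt_id' _).const_mul R.lam).exp).sub_const 1
  rw [weight, hderiv.deriv, mul_one, mul_comm]

lemma weight_nonneg (hlam : 0 ≤ R.lam) (k : ℕ) : 0 ≤ R.weight P k := by
  rw [weight_eq]
  positivity

lemma weight_mono (hlam : 0 ≤ R.lam) : Monotone (R.weight P) := by
  intro k l hkl
  have hviolation := P.violation_mono R.x (by omega : k - P.m - 1 ≤ l - P.m - 1)
  rw [weight_eq, weight_eq]
  gcongr

lemma weight_eq_lam (hP : P.Assumptions F G Lf Lg) (hk : k ≤ 2 * P.m + 1) :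
    R.weight P k = R.lam := by
  rw [weight_eq, hP.violation_eq_zero R.x (by omega), mul_zero, Real.exp_zero, mul_one]

lemma weight_le (hlam : 0 ≤ R.lam) (hk : k ≤ P.T + P.m + 1) :
    R.weight P k ≤ R.lam * Real.exp (R.lam * P.violation R.x P.T) := by
  have hviolation := P.violation_mono R.x (by omega : k - P.m - 1 ≤ P.T)
  rw [weight_eq]
  gcongr

lemma IsODAF.rho_nonneg (hR : R.IsODAF P Lf Lg ρ) : 0 ≤ ρ :=
  (hR.r_nonneg _ (hR.mem 0 P.T.zero_le)).trans (hR.r_le _ (hR.mem 0 P.T.zero_le))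

lemma IsODAF.Lf_nonneg (hR : R.IsODAF P Lf Lg ρ) : 0 ≤ Lf :=
  (norm_nonneg _).trans (hR.predF_le 0 0 0)

lemma IsODAF.Lg_nonneg (hR : R.IsODAF P Lf Lg ρ) : 0 ≤ Lg :=
  (norm_nonneg _).trans (hR.predG_le 0 0 0)

lemma IsODAF.norm_gradG_le (hR : R.IsODAF P Lf Lg ρ) (hP : P.Assumptions F G Lf Lg)
    (hs : s ≤ P.T) (hi : i ≤ P.m) : ‖R.gradG s i‖ ≤ Lg :=
  ((hR.subgrad s hs i hi).norm_le ((P.g (s + i) i).lipschitzWith_eval.max_const 0)).trans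
    (hP.norm_slope_g_le hR.Lg_nonneg _ hi)

lemma IsODAF.norm_gradZ_le (hR : R.IsODAF P Lf Lg ρ) (hP : P.Assumptions F G Lf Lg)
    (hlam : 0 ≤ R.lam) (hs : s ≤ P.T) (hsm : s ≤ P.m + 1) :
    ‖R.gradZ P s‖ ≤ (P.m + 1) * (Lf + R.lam * Lg) := by
  have hLf := hR.Lf_nonneg
  have hLg := hR.Lg_nonneg
  have hsum : ‖R.gradZ P s‖ ≤ ↑(P.m + 1) * (Lf + R.lam * Lg) := by
    refine norm_sum_le_mul_of_card_le (card_range _).le (by positivity) fun i hi => ?_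
    have him : i ≤ P.m := mem_range_succ_iff.1 hi
    rw [weight_eq_lam hP (by omega)]
    refine norm_add_le_of_le (hP.norm_slope_f_le hLf _ him) ?_
    rw [norm_smul, Real.norm_of_nonneg hlam]
    exact mul_le_mul_of_nonneg_left (hR.norm_gradG_le hP hs him) hlam
  exact_mod_cast hsum

lemma IsODAF.sum_norm_gradZ_le (hR : R.IsODAF P Lf Lg ρ) (hP : P.Assumptions F G Lf Lg)
    (hlam : 0 ≤ R.lam) :
    ∑ s ∈ Icc 1 (min P.T (P.m + 1)), ‖R.gradZ P s‖ ≤ (P.m + 1) ^ 2 * (Lf + R.lam * Lg) := by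
  have hLf := hR.Lf_nonneg
  have hLg := hR.Lg_nonneg
  have hsum := sum_le_mul_of_card_le (s := Icc 1 (min P.T (P.m + 1))) (n := P.m + 1)
    (f := fun s => ‖R.gradZ P s‖) (B := (P.m + 1) * (Lf + R.lam * Lg))
    (by simp) (by positivity) fun s hs => by
      have hs' := mem_Icc.1 hs
      exact hR.norm_gradZ_le hP hlam (by omega) (by omega)
  push_cast at hsum
  linarith

lemma epsF_nonneg (R : Run d) (P : Problem d) (t : ℕ) : 0 ≤ R.epsF P t := sq_nonneg _

lemma sq_norm_tail_le_epsG (R : Run d) (P : Problem d) (t : ℕ) (hj : j ≤ P.m) :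
    ‖∑ s ∈ Icc (t - P.m) t, ∑ i ∈ Icc (t + j - s) P.m, (R.predG t s i - R.gradG s i)‖ ^ 2 ≤
      R.epsG P t :=
  le_sup' (fun j => ‖∑ s ∈ Icc (t - P.m) t, ∑ i ∈ Icc (t + j - s) P.m,
    (R.predG t s i - R.gradG s i)‖ ^ 2) (mem_range_succ_iff.2 hj)

lemma epsG_nonneg (R : Run d) (P : Problem d) (t : ℕ) : 0 ≤ R.epsG P t :=
  (sq_nonneg _).trans (R.sq_norm_tail_le_epsG P t P.m.zero_le)

lemma hint_sub_sum_gradZ (R : Run d) (P : Problem d) (t : ℕ) :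
    R.hint P t - ∑ s ∈ Icc (t - P.m) t, R.gradZ P s =
      ∑ s ∈ Icc (t - P.m) t, ∑ i ∈ Icc (t - s) P.m, (R.predF t s i - (P.f (s + i) i).slope) +
      ∑ s ∈ Icc (t - P.m) t, ∑ i ∈ Icc (t - s) P.m,
        R.weight P (s + i) • (R.predG t s i - R.gradG s i) := by
  rw [hint, ← sum_sub_distrib, ← sum_add_distrib]
  refine sum_congr rfl fun s _ => ?_
  have hunknown : Icc (t - s) P.m = {i ∈ range (P.m + 1) | ¬ s + i < t} := by
    ext i
    simp only [mem_Icc, mem_filter, mem_range]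
    omega
  rw [gradZ, ← sum_sub_distrib, ← sum_add_distrib, hunknown, sum_filter]
  refine sum_congr rfl fun i _ => ?_
  by_cases h : s + i < t
  · rw [if_pos h, if_neg (not_not.2 h), sub_self]
  · rw [if_neg h, if_pos h, smul_sub]
    abel

lemma hintErr_le (hlam : 0 ≤ R.lam) (t : ℕ) :
    R.hintErr P t ≤ √(R.epsF P t) + R.weight P (t + P.m) * √(R.epsG P t) := by
  rw [hintErr, hint_sub_sum_gradZ]
  refine norm_add_le_of_le (Real.le_sqrt_of_sq_le le_rfl) ?_
  exact norm_sum_sum_monotone_smul_le (weight_mono hlam) (weight_nonneg hlam) fun j hj =>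
    Real.le_sqrt_of_sq_le (R.sq_norm_tail_le_epsG P t hj)

lemma IsODAF.sqrt_epsF_le (hR : R.IsODAF P Lf Lg ρ) (hP : P.Assumptions F G Lf Lg) (t : ℕ) :
    √(R.epsF P t) ≤ (P.m + 1) ^ 2 * (2 * Lf) := by
  have hLf := hR.Lf_nonneg
  rw [epsF, Real.sqrt_sq (norm_nonneg _), two_mul]
  exact norm_sum_sum_le (by positivity) fun s _ i hi =>
    norm_sub_le_of_le (hR.predF_le t s i) (hP.norm_slope_f_le hLf (s + i) hi)

lemma IsODAF.sqrt_epsG_le (hR : R.IsODAF P Lf Lg ρ) (hP : P.Assumptions F G Lf Lg)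
    (ht : t ≤ P.T) : √(R.epsG P t) ≤ (P.m + 1) ^ 2 * (2 * Lg) := by
  have hLg := hR.Lg_nonneg
  rw [two_mul]
  refine Real.sqrt_le_iff.2 ⟨by positivity, sup'_le _ _ fun j _ => ?_⟩
  exact pow_le_pow_left₀ (norm_nonneg _) (norm_sum_sum_le (by positivity) fun s hs i hi =>
    norm_sub_le_of_le (hR.predG_le t s i) (hR.norm_gradG_le hP (hs.trans ht) hi)) 2

lemma IsODAF.hintErr_le_of_lt (hR : R.IsODAF P Lf Lg ρ) (hP : P.Assumptions F G Lf Lg)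
    (hlam : 0 ≤ R.lam) (ht : t ≤ P.T) (htm : t < P.m) :
    R.hintErr P t ≤ 2 * (P.m + 1) ^ 2 * (Lf + R.lam * Lg) := by
  have herr := hintErr_le (P := P) hlam t
  have hloss := hR.sqrt_epsF_le hP t
  have hconstr := mul_le_mul_of_nonneg_left (hR.sqrt_epsG_le hP ht) hlam
  rw [weight_eq_lam hP (by omega)] at herr
  linarith

lemma IsODAF.sqrt_errF_le (hR : R.IsODAF P Lf Lg ρ) (hP : P.Assumptions F G Lf Lg)
    (hmT : P.m ≤ P.T) : √(R.errF P) ≤ (P.T + 1) ^ 3 * (2 * Lf) := by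
  have hLf := hR.Lf_nonneg
  have hround : ∀ t ∈ Icc P.m P.T, R.epsF P t ≤ ((P.T + 1) ^ 2 * (2 * Lf)) ^ 2 := fun t _ =>
    (Real.sqrt_le_left (by positivity)).1 ((hR.sqrt_epsF_le hP t).trans (by gcongr))
  have hsum := sum_le_mul_of_card_le (n := P.T + 1) (by rw [Nat.card_Icc]; omega)
    (by positivity) hround
  refine Real.sqrt_le_iff.2 ⟨by positivity, ?_⟩
  calc R.errF P ≤ (P.T + 1) * ((P.T + 1) ^ 2 * (2 * Lf)) ^ 2 := by exact_mod_cast hsum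
    _ ≤ (P.T + 1) ^ 2 * ((P.T + 1) ^ 2 * (2 * Lf)) ^ 2 := by
        gcongr
        exact le_self_pow₀ (by simp) two_ne_zero
    _ = ((P.T + 1) ^ 3 * (2 * Lf)) ^ 2 := by ring

end Run

/-! ### Regret and violation -/

lemma sum_memory_reindex {M : Type*} [AddCommMonoid M] {m T : ℕ} {H : ℕ → ℕ → ℕ → M}
    (hH : ∀ t, t ≤ m ∨ T < t → ∀ i s, H t i s = 0) :
    ∑ t ∈ Icc m T, ∑ i ∈ range (m + 1), H t i (t - i) =
      ∑ s ∈ Icc 1 T, ∑ i ∈ range (m + 1), H (s + i) i s := by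
  have hstart : ∑ t ∈ Icc m T, ∑ i ∈ range (m + 1), H t i (t - i) =
      ∑ t ∈ Icc (m + 1) T, ∑ i ∈ range (m + 1), H t i (t - i) := by
    refine (sum_subset (Icc_subset_Icc_left m.le_succ) fun t ht ht' => ?_).symm
    simp only [mem_Icc] at ht ht'
    exact sum_eq_zero fun i _ => hH t (by omega) _ _
  rw [hstart, sum_comm, sum_comm (s := Icc 1 T)]
  refine sum_congr rfl fun i hi => ?_
  have him : i ≤ m := mem_range_succ_iff.1 hi
  refine sum_of_injOn (· - i) (fun s hs t ht hst => ?_) (fun t ht => ?_) (fun s _ hs' => ?_)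
    fun t ht => ?_
  · simp only [coe_Icc, Set.mem_Icc] at hs ht hst
    omega
  · simp only [coe_Icc, Set.mem_Icc] at ht ⊢
    omega
  · refine hH _ ?_ _ _
    by_contra! hmem
    exact hs' ⟨s + i, by simpa using hmem, Nat.add_sub_cancel s i⟩
  · rw [Nat.sub_add_cancel (him.trans (m.le_succ.trans (mem_Icc.1 ht).1))]

lemma max_memVal_zero_le {d : ℕ} (m : ℕ) (φ : ℕ → LinFun d) (y : ℕ → Space d) :
    max (memVal m φ y) 0 ≤ ∑ i ∈ range (m + 1), max ((φ i).eval (y i)) 0 :=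
  max_le (sum_le_sum fun _ _ => le_max_left _ _) (sum_nonneg fun _ _ => le_max_right _ _)

lemma Problem.Assumptions.max_eval_g_eq_zero {d : ℕ} {P : Problem d} {F G Lf Lg : ℝ} {u : Space d}
    {i : ℕ} (hP : P.Assumptions F G Lf Lg) (hu : u ∈ P.benchmark) (t : ℕ) (hi : i ≤ P.m) :
    max ((P.g t i).eval u) 0 = 0 := by
  by_cases ht : t ≤ P.m ∨ P.T < t
  · simp [hP.g_zero t ht i, LinFun.eval]
  · exact max_eq_right (hu.2 t (mem_Icc.2 (by omega)) i hi)

/-- The diameter-uniform version `(ρ / α + 1) (2 D + √(D² + α))` of the factor of the hint errors in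
the regret of FTRL; the dependence on the memory length is split off as a factor `m + 1`. -/
noncomputable def ftrlConst (D α ρ : ℝ) : ℝ := (ρ / α + 1) * (2 * D + √(D ^ 2 + α))

/-- The factor of `(m + 1)⁴` in the part of the regret that is due to the initial history, in which
the gradients are bounded by `Lf + λ Lg ≤ Lf + Lg / (2 G)` per slice. -/
noncomputable def memoryConst (D α ρ G Lf Lg : ℝ) : ℝ :=
  2 * (D + ftrlConst D α ρ) * (Lf + Lg / (2 * G))

/-- The factor of `(T + 1)⁴` in the bound on the exponential of the final violation. -/
noncomputable def expViolationConst (D α ρ F G Lf Lg : ℝ) : ℝ :=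
  10 * (2 * F + √2 * ftrlConst D α ρ * (2 * Lf) + 1 + memoryConst D α ρ G Lf Lg)

/-- The constant `K` of the violation bound. -/
noncomputable def violationConst (D α ρ F G Lf Lg : ℝ) : ℝ :=
  2 * max 1 G * (Real.log (expViolationConst D α ρ F G Lf Lg) / Real.log 2 + 8)

section Constants

variable {α ρ G Lf Lg B D Δ : ℝ}

lemma ftrlConst_nonneg (hα : 0 < α) (hρ : 0 ≤ ρ) (hD : 0 ≤ D) : 0 ≤ ftrlConst D α ρ := by
  rw [ftrlConst]
  positivity

lemma memoryConst_nonneg (hα : 0 < α) (hρ : 0 ≤ ρ) (hD : 0 ≤ D) (hG : 0 < G) (hLf : 0 ≤ Lf)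
    (hLg : 0 ≤ Lg) : 0 ≤ memoryConst D α ρ G Lf Lg := by
  have := ftrlConst_nonneg hα hρ hD
  rw [memoryConst]
  positivity

lemma regretConst_nonneg (m : ℕ) (hα : 0 < α) (hρ : 0 ≤ ρ) (hΔ : 0 ≤ Δ) :
    0 ≤ regretConst m Δ α ρ := by
  rw [regretConst]
  positivity

lemma mul_ftrl_factor_le (m : ℕ) (hα : 0 < α) (hρ : 0 ≤ ρ) (hΔ : 0 ≤ Δ) (hD : Δ ≤ D) :
    (ρ / α + 1) * (2 * m * Δ + √(Δ ^ 2 + α)) ≤ ftrlConst D α ρ * (m + 1) := by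
  have hsqrt : √(Δ ^ 2 + α) ≤ √(D ^ 2 + α) := by gcongr
  have hmD : (m : ℝ) * Δ ≤ m * D := by gcongr
  have hmsqrt : 0 ≤ (m : ℝ) * √(D ^ 2 + α) := by positivity
  rw [ftrlConst, mul_assoc (ρ / α + 1)]
  refine mul_le_mul_of_nonneg_left ?_ (by positivity)
  linarith

lemma regretConst_le (m : ℕ) (hα : 0 < α) (hρ : 0 ≤ ρ) (hΔ : 0 ≤ Δ) (hD : Δ ≤ D) :
    regretConst m Δ α ρ ≤ √2 * ftrlConst D α ρ * (m + 1) := by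
  have hle := mul_le_mul_of_nonneg_left (mul_ftrl_factor_le m hα hρ hΔ hD) (Real.sqrt_nonneg 2)
  rwa [← mul_assoc, ← mul_assoc] at hle

lemma history_le (m : ℕ) (hα : 0 < α) (hρ : 0 ≤ ρ) (hΔ : 0 ≤ Δ) (hD : Δ ≤ D) (hB : 0 ≤ B) :
    2 * Δ * ((m + 1) ^ 2 * B) +
        (ρ / α + 1) * (2 * m * Δ + √(Δ ^ 2 + α)) * (m * (2 * (m + 1) ^ 2 * B)) ≤
      2 * (D + ftrlConst D α ρ) * B * (m + 1) ^ 4 := by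
  have hD₀ : 0 ≤ D := hΔ.trans hD
  have hq := ftrlConst_nonneg hα hρ hD₀
  calc _ ≤ 2 * D * ((m + 1) ^ 4 * B) +
        ftrlConst D α ρ * (m + 1) * ((m + 1) * (2 * (m + 1) ^ 2 * B)) := by
        refine add_le_add ?_ (mul_le_mul (mul_ftrl_factor_le m hα hρ hΔ hD) ?_ (by positivity)
          (by positivity))
        · gcongr
          · simp
          · norm_num
        · gcongr
          simp
    _ = 2 * (D + ftrlConst D α ρ) * B * (m + 1) ^ 4 := by ring

end Constants

namespace Run

variable {d : ℕ} {R : Run d} {P : Problem d} {D F G Lf Lg ρ : ℝ} {u : Space d} {s i t : ℕ}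

lemma sum_hintErr_sq_le (hlam : 0 ≤ R.lam) :
    ∑ t ∈ Icc P.m P.T, R.hintErr P t ^ 2 ≤ 2 * R.errF P +
      2 * ((R.lam * Real.exp (R.lam * P.violation R.x P.T)) ^ 2 * R.errG P) := by
  rw [errF, errG, mul_sum, mul_sum, mul_sum, ← sum_add_distrib]
  refine sum_le_sum fun t ht => ?_
  have herr := (hintErr_le (P := P) hlam t).trans (add_le_add_right (mul_le_mul_of_nonneg_right
    (weight_le hlam (by have := mem_Icc.1 ht; omega)) (Real.sqrt_nonneg (R.epsG P t))) _)
  have hsq : R.hintErr P t ^ 2 ≤ _ := (pow_le_pow_left₀ (norm_nonneg _) herr 2).trans add_sq_le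
  rw [mul_pow, Real.sq_sqrt (R.epsF_nonneg P t), Real.sq_sqrt (R.epsG_nonneg P t)] at hsq
  linarith

lemma IsODAF.sqrt_sum_history_hintErr_le (hR : R.IsODAF P Lf Lg ρ) (hP : P.Assumptions F G Lf Lg)
    (hlam : 0 ≤ R.lam) (hmT : P.m ≤ P.T) :
    √(∑ t ∈ range P.m, R.hintErr P t ^ 2) ≤ P.m * (2 * (P.m + 1) ^ 2 * (Lf + R.lam * Lg)) := by
  have hLf := hR.Lf_nonneg
  have hLg := hR.Lg_nonneg
  have hnonneg : ∀ t ∈ range P.m, 0 ≤ R.hintErr P t := fun t _ => norm_nonneg _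
  refine (Real.sqrt_le_left (sum_nonneg hnonneg)).2 (sum_sq_le_sq_sum_of_nonneg hnonneg)
    |>.trans ?_
  refine sum_le_mul_of_card_le (card_range _).le (by positivity) fun t ht => ?_
  have htm := mem_range.1 ht
  exact hR.hintErr_le_of_lt hP hlam (htm.le.trans hmT) htm

lemma IsODAF.sqrt_sum_hintErr_le (hR : R.IsODAF P Lf Lg ρ) (hP : P.Assumptions F G Lf Lg)
    (hlam : 0 ≤ R.lam) (hmT : P.m ≤ P.T) :
    √(∑ t ∈ range (P.T + 1), R.hintErr P t ^ 2) ≤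
      √2 * √(R.errF P) +
        √2 * (R.lam * Real.exp (R.lam * P.violation R.x P.T) * √(R.errG P)) +
        P.m * (2 * (P.m + 1) ^ 2 * (Lf + R.lam * Lg)) := by
  have hF : 0 ≤ R.errF P := sum_nonneg fun t _ => R.epsF_nonneg P t
  have hG : 0 ≤ R.errG P := sum_nonneg fun t _ => R.epsG_nonneg P t
  have hsplit : ∑ t ∈ range (P.T + 1), R.hintErr P t ^ 2 =
      ∑ t ∈ Icc P.m P.T, R.hintErr P t ^ 2 + ∑ t ∈ range P.m, R.hintErr P t ^ 2 := by
    rw [← sum_range_add_sum_Ico _ (hmT.trans P.T.le_succ), add_comm]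
    rfl
  rw [hsplit]
  refine (sqrt_add_le (sum_nonneg fun t _ => sq_nonneg _) (sum_nonneg fun t _ => sq_nonneg _)).trans
    (add_le_add ?_ (hR.sqrt_sum_history_hintErr_le hP hlam hmT))
  refine (Real.sqrt_le_sqrt (sum_hintErr_sq_le hlam)).trans
    ((sqrt_add_le (by positivity) (by positivity)).trans_eq ?_)
  rw [Real.sqrt_mul zero_le_two, Real.sqrt_mul zero_le_two, Real.sqrt_mul (sq_nonneg _),
    Real.sqrt_sq (by positivity)]

lemma muNext_eq (R : Run d) (P : Problem d) (t : ℕ) :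
    R.muNext P t = ftrlBound P.X P.m R.α (R.gradZ P) (R.hint P) (t - P.m) / R.α := by
  have hdrift : R.aTerm P = driftCap P.X P.m (R.gradZ P) (R.hint P) := rfl
  have hhuber : R.bTerm P = huberCap P.m (R.gradZ P) (R.hint P) := rfl
  rw [muNext, ftrlBound, delayedBound, maxWindow, hdrift, hhuber]
  ring

lemma IsODAF.isDelayedFTRL (hR : R.IsODAF P Lf Lg ρ) :
    IsDelayedFTRL P.X R.r P.m P.T (R.gradZ P) (R.hint P) (fun t => R.muNext P (t - 1)) R.x where
  mem := hR.mem
  isMinOn t hmt htT := by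
    obtain ⟨n, rfl⟩ : ∃ n, t = n + 1 := ⟨t - 1, by omega⟩
    exact hR.update n (by omega) htT

lemma IsODAF.sum_inner_gradZ_le (hR : R.IsODAF P Lf Lg ρ) (hP : P.Assumptions F G Lf Lg)
    (hα : 0 < R.α) (hlam : 0 ≤ R.lam) (hmT : P.m ≤ P.T) (hD : Metric.diam P.X ≤ D)
    (hu : u ∈ P.X) :
    ∑ s ∈ Icc 1 P.T, ⟪R.gradZ P s, R.x s - u⟫ ≤
      regretConst P.m (Metric.diam P.X) R.α ρ * √(R.errF P) +
        R.lam * (regretConst P.m (Metric.diam P.X) R.α ρ * √(R.errG P)) *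
          Real.exp (R.lam * P.violation R.x P.T) +
        2 * (D + ftrlConst D R.α ρ) * (Lf + R.lam * Lg) * (P.m + 1) ^ 4 := by
  have hρ := hR.rho_nonneg
  have hLf := hR.Lf_nonneg
  have hLg := hR.Lg_nonneg
  have hΔ : 0 ≤ Metric.diam P.X := Metric.diam_nonneg
  have hftrl := hR.isDelayedFTRL.sum_inner_sub_le hP.bounded hR.r_nonneg hR.r_le hR.strong hα
    (fun t => R.muNext_eq P (t - 1)) hu
  have hfactor : 0 ≤ (ρ / R.α + 1) *
    (2 * P.m * Metric.diam P.X + √(Metric.diam P.X ^ 2 + R.α)) := by positivity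
  have hhint := mul_le_mul_of_nonneg_left (hR.sqrt_sum_hintErr_le hP hlam hmT) hfactor
  have hgrad := mul_le_mul_of_nonneg_left (hR.sum_norm_gradZ_le hP hlam)
    (mul_nonneg zero_le_two hΔ)
  have hhistory := history_le P.m hα hρ hΔ hD (by positivity : 0 ≤ Lf + R.lam * Lg)
  have hdelay : ∀ t, delayErr P.m (R.gradZ P) (R.hint P) t = R.hintErr P t := fun t => rfl
  simp only [hdelay] at hftrl
  rw [regretConst]
  linarith

lemma IsODAF.slice_le_inner (hR : R.IsODAF P Lf Lg ρ) (hP : P.Assumptions F G Lf Lg)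
    (hlam : 0 ≤ R.lam) (hu : u ∈ P.benchmark) (hs : s ≤ P.T) (hi : i ≤ P.m) :
    (P.f (s + i) i).eval (R.x s) - (P.f (s + i) i).eval u +
        R.weight P (s + i) * max ((P.g (s + i) i).eval (R.x s)) 0 ≤
      ⟪(P.f (s + i) i).slope + R.weight P (s + i) • R.gradG s i, R.x s - u⟫ := by
  have hsub : max ((P.g (s + i) i).eval (R.x s)) 0 + ⟪R.gradG s i, u - R.x s⟫ ≤
      max ((P.g (s + i) i).eval u) 0 := hR.subgrad s hs i hi u
  rw [hP.max_eval_g_eq_zero hu _ hi, ← neg_sub, inner_neg_right, ← sub_eq_add_neg, sub_nonpos]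
    at hsub
  rw [inner_add_left, real_inner_smul_left, LinFun.eval_sub]
  exact add_le_add_right (mul_le_mul_of_nonneg_left hsub (weight_nonneg hlam _)) _

lemma IsODAF.regret_add_penalty_le (hR : R.IsODAF P Lf Lg ρ) (hP : P.Assumptions F G Lf Lg)
    (hlam : 0 ≤ R.lam) (hu : u ∈ P.benchmark) :
    ∑ t ∈ Icc P.m P.T, P.lossAt R.x t - ∑ t ∈ Icc P.m P.T, P.lossAt (fun _ => u) t +
        ∑ t ∈ Icc P.m P.T, R.weight P t * max (P.constrAt R.x t) 0 ≤
      ∑ s ∈ Icc 1 P.T, ⟪R.gradZ P s, R.x s - u⟫ := by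
  set slice : ℕ → ℕ → ℕ → ℝ := fun t i s => (P.f t i).eval (R.x s) - (P.f t i).eval u +
    R.weight P t * max ((P.g t i).eval (R.x s)) 0
  have hzero : ∀ t, t ≤ P.m ∨ P.T < t → ∀ i s, slice t i s = 0 := fun t ht i s => by
    simp [slice, hP.f_zero t ht i, hP.g_zero t ht i, LinFun.eval]
  calc _ ≤ ∑ t ∈ Icc P.m P.T, ∑ i ∈ range (P.m + 1), slice t i (t - i) := by
        rw [← sum_sub_distrib, ← sum_add_distrib]
        refine sum_le_sum fun t _ => ?_
        simp only [slice, sum_add_distrib, sum_sub_distrib, ← mul_sum]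
        exact add_le_add_right
          (mul_le_mul_of_nonneg_left (max_memVal_zero_le _ _ _) (weight_nonneg hlam t)) _
    _ = ∑ s ∈ Icc 1 P.T, ∑ i ∈ range (P.m + 1), slice (s + i) i s := sum_memory_reindex hzero
    _ ≤ ∑ s ∈ Icc 1 P.T, ⟪R.gradZ P s, R.x s - u⟫ := by
        refine sum_le_sum fun s hs => ?_
        rw [gradZ, sum_inner]
        exact sum_le_sum fun i hi =>
          hR.slice_le_inner hP hlam hu (mem_Icc.1 hs).2 (mem_range_succ_iff.1 hi)

lemma IsODAF.mul_exp_violation_le (hR : R.IsODAF P Lf Lg ρ) (hP : P.Assumptions F G Lf Lg)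
    (hG : 0 ≤ G) (hlam : 0 ≤ R.lam) (hlamG : R.lam * (G * (P.m + 1)) ≤ 1 / 2) (ht : t ≤ P.T) :
    R.lam * Real.exp (R.lam * P.violation R.x t) ≤ Real.exp (1 / 2) * R.weight P t := by
  have hviolation := mul_le_mul_of_nonneg_left
    (hP.violation_le_sub_add hG hR.mem ht (P.m + 1)) hlam
  rw [weight_eq, mul_left_comm, ← Real.exp_add, Nat.sub_sub]
  refine mul_le_mul_of_nonneg_left (Real.exp_le_exp.2 ?_) hlam
  push_cast at hviolation
  linarith

lemma IsODAF.exp_violation_le (hR : R.IsODAF P Lf Lg ρ) (hP : P.Assumptions F G Lf Lg)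
    (hG : 0 ≤ G) (hlam : 0 ≤ R.lam) (hlamG : R.lam * (G * (P.m + 1)) ≤ 1 / 2) (hmt : P.m ≤ t)
    (ht : t ≤ P.T) :
    Real.exp (R.lam * P.violation R.x t) - 1 ≤
      Real.exp (1 / 2) * ∑ k ∈ Icc P.m t, R.weight P k * max (P.constrAt R.x k) 0 := by
  induction t, hmt using Nat.le_induction with
  | base =>
    rw [hP.violation_eq_zero R.x le_rfl, mul_zero, Real.exp_zero, sub_self]
    exact mul_nonneg (Real.exp_nonneg _)
      (sum_nonneg fun k _ => mul_nonneg (weight_nonneg hlam k) (le_max_right _ _))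
  | succ t hmt ih =>
    have hprev := ih (by omega)
    have hstep := exp_sub_exp_le (R.lam * P.violation R.x t) (R.lam * P.violation R.x (t + 1))
    have hweight := mul_le_mul_of_nonneg_right (hR.mul_exp_violation_le hP hG hlam hlamG ht)
      (le_max_right (P.constrAt R.x (t + 1)) 0)
    have hincr : R.lam * P.violation R.x (t + 1) - R.lam * P.violation R.x t =
        R.lam * max (P.constrAt R.x (t + 1)) 0 := by
      rw [← mul_sub, P.violation_succ R.x (by omega), add_sub_cancel_left]
    rw [hincr] at hstep
    rw [sum_Icc_succ_top (by omega)]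
    linarith

/-- The penalty parameter is small enough for the violation to grow by at most a constant factor
during the delay, and for the prediction errors of the constraints to be absorbed by the penalty. -/
structure IsTuned (R : Run d) (P : Problem d) (G ρ : ℝ) : Prop where
  nonneg : 0 ≤ R.lam
  mul_bound_le : R.lam * (G * (P.m + 1)) ≤ 1 / 2
  mul_error_le : R.lam * (regretConst P.m (Metric.diam P.X) R.α ρ * √(R.errG P)) ≤ 1 / 2

end Run

lemma Problem.Assumptions.F_nonneg {d : ℕ} {P : Problem d} {F G Lf Lg : ℝ} {u : Space d}
    (hP : P.Assumptions F G Lf Lg) (hmT : P.m ≤ P.T) (hu : u ∈ P.X) : 0 ≤ F :=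
  (abs_nonneg _).trans (hP.f_bdd P.m (left_mem_Icc.2 hmT) (fun _ => u) fun _ _ => hu)

lemma one_le_expViolationConst {D α ρ F G Lf Lg : ℝ} (hα : 0 < α) (hρ : 0 ≤ ρ) (hD : 0 ≤ D)
    (hF : 0 ≤ F) (hG : 0 < G) (hLf : 0 ≤ Lf) (hLg : 0 ≤ Lg) :
    1 ≤ expViolationConst D α ρ F G Lf Lg := by
  have hftrl := ftrlConst_nonneg hα hρ hD
  have hmemory := memoryConst_nonneg hα hρ hD hG hLf hLg
  have hregret : 0 ≤ √2 * ftrlConst D α ρ * (2 * Lf) := by positivity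
  rw [expViolationConst]
  linarith

namespace Run

variable {d : ℕ} {R : Run d} {P : Problem d} {C D F G Lf Lg ρ : ℝ}

lemma IsODAF.isTuned (hR : R.IsODAF P Lf Lg ρ) (hα : 0 < R.α) (hG : 0 < G)
    (hC : regretConst P.m (Metric.diam P.X) R.α ρ ≤ C)
    (hlam : R.lam = 1 / (2 * (C * √(R.errG P) + G * (P.m + 1)))) : R.IsTuned P G ρ := by
  have hC₀ : 0 ≤ C :=
    (regretConst_nonneg P.m hα hR.rho_nonneg Metric.diam_nonneg).trans hC
  have herr : 0 ≤ C * √(R.errG P) := by positivity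
  have hmemory : 0 < G * (P.m + 1) := by positivity
  have herr_le := mul_le_mul_of_nonneg_right hC (Real.sqrt_nonneg (R.errG P))
  refine ⟨?_, ?_, ?_⟩ <;> rw [hlam]
  · positivity
  · exact one_div_two_mul_mul_le_half (by positivity) (by linarith)
  · exact one_div_two_mul_mul_le_half (by positivity) (by linarith)

lemma IsTuned.lam_le (htuned : R.IsTuned P G ρ) (hG : 0 < G) : R.lam ≤ 1 / (2 * G) := by
  have hmemory : 0 ≤ R.lam * G * P.m :=
    mul_nonneg (mul_nonneg htuned.nonneg hG.le) (Nat.cast_nonneg _)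
  rw [le_div_iff₀ (by positivity)]
  linarith [htuned.mul_bound_le]

lemma IsODAF.memory_le_memoryConst (hR : R.IsODAF P Lf Lg ρ) (htuned : R.IsTuned P G ρ)
    (hα : 0 < R.α) (hG : 0 < G) (hD : 0 ≤ D) :
    2 * (D + ftrlConst D R.α ρ) * (Lf + R.lam * Lg) ≤ memoryConst D R.α ρ G Lf Lg := by
  have hftrl := ftrlConst_nonneg hα hR.rho_nonneg hD
  have hlamLg := mul_le_mul_of_nonneg_right (htuned.lam_le hG) hR.Lg_nonneg
  rw [one_div_mul_eq_div] at hlamLg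
  rw [memoryConst]
  gcongr

lemma IsODAF.regret_add_exp_violation_le (hR : R.IsODAF P Lf Lg ρ) (hP : P.Assumptions F G Lf Lg)
    (htuned : R.IsTuned P G ρ) (hα : 0 < R.α) (hG : 0 < G) (hmT : P.m ≤ P.T)
    (hD : Metric.diam P.X ≤ D) (hne : P.benchmark.Nonempty) :
    P.regret R.x + Real.exp (R.lam * P.violation R.x P.T) / 10 ≤
      regretConst P.m (Metric.diam P.X) R.α ρ * √(R.errF P) +
        (1 + memoryConst D R.α ρ G Lf Lg * (P.m + 1) ^ 4) := by
  set X := Real.exp (R.lam * P.violation R.x P.T)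
  set S := ∑ t ∈ Icc P.m P.T, R.weight P t * max (P.constrAt R.x t) 0
  have hS : 0 ≤ S :=
    sum_nonneg fun t _ => mul_nonneg (weight_nonneg htuned.nonneg t) (le_max_right _ _)
  -- `S ≥ 3 / 5 (X - 1)`, of which `X / 2` pays for the prediction errors of the constraints.
  have hpenalty : X - 1 ≤ 5 / 3 * S :=
    (hR.exp_violation_le hP hG.le htuned.nonneg htuned.mul_bound_le hmT le_rfl).trans
      (mul_le_mul_of_nonneg_right exp_half_le hS)
  have herror := mul_le_mul_of_nonneg_right htuned.mul_error_le (Real.exp_nonneg _ : 0 ≤ X)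
  have hmemory := mul_le_mul_of_nonneg_right
    (hR.memory_le_memoryConst htuned hα hG (Metric.diam_nonneg.trans hD))
    (by positivity : (0 : ℝ) ≤ (P.m + 1) ^ 4)
  have hcomparator : ∑ t ∈ Icc P.m P.T, P.lossAt R.x t + X / 10 -
      (regretConst P.m (Metric.diam P.X) R.α ρ * √(R.errF P) +
        (1 + memoryConst D R.α ρ G Lf Lg * (P.m + 1) ^ 4)) ≤
      sInf ((fun u => ∑ t ∈ Icc P.m P.T, P.lossAt (fun _ => u) t) '' P.benchmark) := by
    refine le_csInf (hne.image _) (Set.forall_mem_image.2 fun u hu => ?_)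
    have hregret := hR.regret_add_penalty_le hP htuned.nonneg hu
    have hlinear := hR.sum_inner_gradZ_le hP hα htuned.nonneg hmT hD hu.1
    linarith
  rw [Problem.regret]
  linarith

lemma IsODAF.exp_violation_le_expViolationConst (hR : R.IsODAF P Lf Lg ρ)
    (hP : P.Assumptions F G Lf Lg) (htuned : R.IsTuned P G ρ) (hα : 0 < R.α) (hG : 0 < G)
    (hmT : P.m ≤ P.T) (hD : Metric.diam P.X ≤ D) (hne : P.benchmark.Nonempty) :
    Real.exp (R.lam * P.violation R.x P.T) ≤
      expViolationConst D R.α ρ F G Lf Lg * (P.T + 1) ^ 4 := by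
  have hρ := hR.rho_nonneg
  have hLf := hR.Lf_nonneg
  have hF := hP.F_nonneg hmT hne.some_mem.1
  have hdiam : 0 ≤ Metric.diam P.X := Metric.diam_nonneg
  have hftrl := ftrlConst_nonneg hα hρ (hdiam.trans hD)
  have hmemory := memoryConst_nonneg hα hρ (hdiam.trans hD) hG hLf hR.Lg_nonneg
  have hpow : (1 : ℝ) ≤ (P.T + 1) ^ 4 := one_le_pow₀ (by simp)
  have hupper : regretConst P.m (Metric.diam P.X) R.α ρ * √(R.errF P) ≤
      √2 * ftrlConst D R.α ρ * (2 * Lf) * (P.T + 1) ^ 4 := by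
    calc _ ≤ √2 * ftrlConst D R.α ρ * (P.T + 1) * ((P.T + 1) ^ 3 * (2 * Lf)) :=
          mul_le_mul ((regretConst_le P.m hα hρ hdiam hD).trans (by gcongr))
            (hR.sqrt_errF_le hP hmT) (Real.sqrt_nonneg _) (by positivity)
      _ = _ := by ring
  have hlower : 2 * F * ((P.T : ℝ) + 1) ≤ 2 * F * (P.T + 1) ^ 4 :=
    mul_le_mul_of_nonneg_left (le_self_pow₀ (by simp) (by norm_num)) (by positivity)
  have hhistory : memoryConst D R.α ρ G Lf Lg * ((P.m : ℝ) + 1) ^ 4 ≤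
      memoryConst D R.α ρ G Lf Lg * (P.T + 1) ^ 4 := by gcongr
  have hneg := hP.neg_le_regret hF hR.mem hne
  have hmain := hR.regret_add_exp_violation_le hP htuned hα hG hmT hD hne
  rw [expViolationConst]
  linarith

lemma IsODAF.lam_mul_violation_le (hR : R.IsODAF P Lf Lg ρ) (hP : P.Assumptions F G Lf Lg)
    (htuned : R.IsTuned P G ρ) (hα : 0 < R.α) (hG : 0 < G) (hmT : P.m ≤ P.T) (hT : 2 ≤ P.T)
    (hD : Metric.diam P.X ≤ D) (hne : P.benchmark.Nonempty) :
    R.lam * P.violation R.x P.T ≤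
      (Real.log (expViolationConst D R.α ρ F G Lf Lg) / Real.log 2 + 8) * Real.log P.T :=
  le_log_of_exp_le (one_le_expViolationConst hα hR.rho_nonneg (Metric.diam_nonneg.trans hD)
      (hP.F_nonneg hmT hne.some_mem.1) hG hR.Lf_nonneg hR.Lg_nonneg) (by exact_mod_cast hT)
    (hR.exp_violation_le_expViolationConst hP htuned hα hG hmT hD hne)

lemma IsODAF.violation_le (hR : R.IsODAF P Lf Lg ρ) (hP : P.Assumptions F G Lf Lg)
    (hα : 0 < R.α) (hG : 0 < G) (hmT : P.m ≤ P.T) (hT : 2 ≤ P.T) (hD : Metric.diam P.X ≤ D)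
    (hne : P.benchmark.Nonempty) (hC : regretConst P.m (Metric.diam P.X) R.α ρ ≤ C)
    (hlam : R.lam = 1 / (2 * (C * √(R.errG P) + G * (P.m + 1)))) :
    P.violation R.x P.T ≤ violationConst D R.α ρ F G Lf Lg *
      (C * √(R.errG P) + (P.m + 1)) * Real.log P.T := by
  have htuned := hR.isTuned hα hG hC hlam
  have hlogV := hR.lam_mul_violation_le hP htuned hα hG hmT hT hD hne
  have hlamV : 0 ≤ R.lam * P.violation R.x P.T :=
    mul_nonneg htuned.nonneg (P.violation_nonneg R.x P.T)
  have herr : 0 ≤ C * √(R.errG P) := mul_nonneg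
    ((regretConst_nonneg P.m hα hR.rho_nonneg Metric.diam_nonneg).trans hC) (Real.sqrt_nonneg _)
  have hmax := add_mul_le_max_mul G herr (by positivity : (0 : ℝ) ≤ P.m + 1)
  calc P.violation R.x P.T =
        2 * (C * √(R.errG P) + G * (P.m + 1)) * (R.lam * P.violation R.x P.T) := by
        rw [hlam]
        field_simp
    _ ≤ 2 * (max 1 G * (C * √(R.errG P) + (P.m + 1))) *
        ((Real.log (expViolationConst D R.α ρ F G Lf Lg) / Real.log 2 + 8) * Real.log P.T) := by
        gcongr
    _ = _ := by
        rw [violationConst]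
        ring

end Run

end CocoMemory

theorem mainTheorem3 (D α ρ F G Lf Lg : ℝ) (hα : 0 < α) (hG : 0 < G) :
    ∃ (K : ℝ) (A : ℕ → ℝ), ∀ (d : ℕ) (P : CocoMemory.Problem d) (R : CocoMemory.Run d) (C : ℝ),
      P.Assumptions F G Lf Lg → Metric.diam P.X ≤ D → P.m ≤ P.T → 2 ≤ P.T →
      P.benchmark.Nonempty →
      R.α = α → R.IsODAF P Lf Lg ρ →
      CocoMemory.regretConst P.m (Metric.diam P.X) α ρ ≤ C →
      R.lam = 1 / (2 * (C * √(R.errG P) + G * (P.m + 1))) →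
      P.regret R.x ≤
          CocoMemory.regretConst P.m (Metric.diam P.X) α ρ * √(R.errF P) + A P.m ∧
        P.violation R.x P.T ≤ K * (C * √(R.errG P) + (P.m + 1)) * Real.log P.T := by
  refine ⟨CocoMemory.violationConst D α ρ F G Lf Lg,
    fun m => 1 + CocoMemory.memoryConst D α ρ G Lf Lg * (m + 1) ^ 4, ?_⟩
  rintro d P R C hP hD hmT hT hne rfl hR hC hlam
  refine ⟨?_, hR.violation_le hP hα hG hmT hT hD hne hC hlam⟩
  have hmain := hR.regret_add_exp_violation_le hP (hR.isTuned hα hG hC hlam) hα hG hmT hD hne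
  linarith [Real.exp_nonneg (R.lam * P.violation R.x P.T)]
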